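/- For a compact set $K\subset\mathbb{R}^2$ let $Y_K(x)=\lambda_1(\{t : (x,t)\in K\})$ and $X_K(y)=\lambda_1(\{t : (t,y)\in K\})$ be its coordinate X-rays, and let $$f_K(x,y)=\int_K \big(|x-\alpha|+|y-\beta|\big)\,d\alpha\,d\beta$$ be its generalized conic function. For a rectangle $B=[a,b]\times[c,d]$ let $\mathcal{L}_B^c$ be the set of all non-empty compact convex sets $L\subset\mathbb{R}^2$ with $\mathrm{pr}_1(L)\times\mathrm{pr}_2(L)=B$, equipped with the Hausdorff metric. Let $\Phi$ send $L\in\mathcal{L}_B^c$ to the function $f_L|_B$ in the space $W$ of continuous functions on $B$, where $W$ carries either the supremum norm or the $L_1$-norm $\int_B|f|$. Regard $\Phi^{-1}$ as a set-valued map from the range $\Phi(\mathcal{L}_B^c)\subset W$ (with the subspace topology) to the subsets of $\mathcal{L}_B^c$: $\Phi^{-1}(w)=\{L\in\mathcal{L}_B^c : f_L|_B=w\}$. It is lower semi-continuous at $w_0$ if for every open set $\mathcal{V}\subset\mathcal{L}_B^c$ meeting $\Phi^{-1}(w_0)$ there is an open neighbourhood $\mathcal{U}$ of $w_0$ in the range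 of $\Phi$ such that $\Phi^{-1}(w)\cap\mathcal{V}\neq\emptyset$ for all $w\in\mathcal{U}$. Theorem 5. Let $K\subset\mathbb{R}^2$ be a compact convex set with non-empty interior, and let $B=\mathrm{pr}_1(K)\times\mathrm{pr}_2(K)$ be its axis-parallel bounding box. Then $K$ is determined by its coordinate X-rays (that is, $K'=K$ for every compact convex set $K'$ with non-empty interior such that $X_{K'}=X_K$ and $Y_{K'}=Y_K$ almost everywhere; equivalently, $K'=K$ for every compact convex set $K'$ with non-empty interior such that $f_{K'}=f_K$) if and only if $\Phi^{-1}$ is lower semi-continuous at $f_K|_B$. This holds for the supremum norm as well as for the $L_1$-norm on $W$. -/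

import Mathlib

open MeasureTheory

/-- The Euclidean plane. -/
abbrev Plane : Type := EuclideanSpace ℝ (Fin 2)

/-- The vertical X-ray function `Y_K x = λ₁ {t | (x, t) ∈ K}`. -/
noncomputable def xrayY (K : Set Plane) (x : ℝ) : ENNReal :=
  volume {t : ℝ | !₂[x, t] ∈ K}

/-- The horizontal X-ray function `X_K y = λ₁ {t | (t, y) ∈ K}`. -/
noncomputable def xrayX (K : Set Plane) (y : ℝ) : ENNReal :=
  volume {t : ℝ | !₂[t, y] ∈ K}

/-- `K` and `L` have the same coordinate X-rays (almost everywhere). -/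
def SameXrays (K L : Set Plane) : Prop :=
  (∀ᵐ x : ℝ, xrayY K x = xrayY L x) ∧ (∀ᵐ y : ℝ, xrayX K y = xrayX L y)

/-- The generalized conic function `f_K`: the integral over the focal set `K` of the taxicab
distance to the given point. -/
noncomputable def conicFun (K : Set Plane) (p : Plane) : ℝ :=
  ∫ q in K, (|p 0 - q 0| + |p 1 - q 1|)

theorem continuous_conicFun {K : Set Plane} (hK : IsCompact K) : Continuous (conicFun K) := by
  unfold conicFun
  apply continuous_parametric_integral_of_continuous _ hK
  unfold Function.uncurry
  fun_prop

/-- The rectangle `[a, b] × [c, d]` with sides parallel to the coordinate axes. -/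
def box (a b c d : ℝ) : Set Plane :=
  {p | p 0 ∈ Set.Icc a b ∧ p 1 ∈ Set.Icc c d}

/-- The product `pr₁(L) × pr₂(L)` of the two coordinate projections of `L`. -/
def prodProj (L : Set Plane) : Set Plane :=
  {p | p 0 ∈ (fun q : Plane => q 0) '' L ∧ p 1 ∈ (fun q : Plane => q 1) '' L}

theorem isCompact_box (a b c d : ℝ) : IsCompact (box a b c d) := by
  have h : box a b c d =
      (EuclideanSpace.equiv (Fin 2) ℝ).toHomeomorph ⁻¹' (Set.Icc ![a, c] ![b, d]) := by
    ext p
    simp [box, Set.mem_Icc, Pi.le_def, Fin.forall_fin_two]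
    tauto
  rw [h, Homeomorph.isCompact_preimage]
  exact isCompact_Icc

instance instCompactSpaceBox (a b c d : ℝ) : CompactSpace (box a b c d) :=
  isCompact_iff_compactSpace.mp (isCompact_box a b c d)

/-- The set of all non-empty compact convex planar sets `L` with `pr₁(L) × pr₂(L) = [a,b] × [c,d]`
(a set of Mathlib's `ConvexBody`, whose members may have empty interior). As a subtype it carries
the Hausdorff metric. -/
def levelSet (a b c d : ℝ) : Set (ConvexBody Plane) :=
  {L | prodProj (L : Set Plane) = box a b c d}

/-- The map `Φ`, sending `L` to the restriction of `f_L` to the box, as a map into the space of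
continuous functions on the box with the supremum norm. -/
noncomputable def conicMap (a b c d : ℝ) (L : levelSet a b c d) : C(box a b c d, ℝ) where
  toFun p := conicFun (L.1 : Set Plane) p
  continuous_toFun := (continuous_conicFun L.1.isCompact).comp continuous_subtype_val

/-- The space of continuous functions on the box, to be equipped with the `L₁`-norm. -/
def ContinuousL1 (a b c d : ℝ) : Type := C(box a b c d, ℝ)

noncomputable instance instAddCommGroupContinuousL1 (a b c d : ℝ) :
    AddCommGroup (ContinuousL1 a b c d) :=
  inferInstanceAs (AddCommGroup C(box a b c d, ℝ))

/-- The Lebesgue measure on the box. -/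
noncomputable def boxMeasure (a b c d : ℝ) : Measure (box a b c d) :=
  Measure.comap Subtype.val (volume : Measure Plane)

theorem integrable_boxMeasure {a b c d : ℝ} (f : C(box a b c d, ℝ)) :
    Integrable (fun p => f p) (boxMeasure a b c d) := by
  have hfin : IsFiniteMeasure (boxMeasure a b c d) := by
    refine ⟨?_⟩
    rw [boxMeasure, comap_subtype_coe_apply (isCompact_box a b c d).measurableSet]
    simpa using (isCompact_box a b c d).measure_lt_top
  exact f.continuous.integrable_of_hasCompactSupport (HasCompactSupport.of_compactSpace _)

/-- The `L₁`-norm `∫_B |f|` of a continuous function on the box `B`. -/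
noncomputable def l1Norm (a b c d : ℝ) : AddGroupSeminorm (ContinuousL1 a b c d) where
  toFun f := ∫ p, |ContinuousMap.toFun f p| ∂(boxMeasure a b c d)
  map_zero' := by
    change ∫ p, |(0 : C(box a b c d, ℝ)) p| ∂(boxMeasure a b c d) = 0
    simp
  add_le' f g := by
    change C(box a b c d, ℝ) at f g
    change ∫ p, |(f + g) p| ∂(boxMeasure a b c d) ≤
      ∫ p, |f p| ∂(boxMeasure a b c d) + ∫ p, |g p| ∂(boxMeasure a b c d)
    rw [← integral_add (integrable_boxMeasure f).abs (integrable_boxMeasure g).abs]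
    exact integral_mono (integrable_boxMeasure (f + g)).abs
      ((integrable_boxMeasure f).abs.add (integrable_boxMeasure g).abs)
      (fun p => abs_add_le (f p) (g p))
  neg' f := by
    change C(box a b c d, ℝ) at f
    change ∫ p, |(-f) p| ∂(boxMeasure a b c d) = ∫ p, |f p| ∂(boxMeasure a b c d)
    simp

noncomputable instance instSeminormedAddCommGroupContinuousL1 (a b c d : ℝ) :
    SeminormedAddCommGroup (ContinuousL1 a b c d) :=
  (l1Norm a b c d).toSeminormedAddCommGroup

/-- The map `Φ` into the space of continuous functions on the box with the `L₁`-norm. -/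
noncomputable def conicMapL1 (a b c d : ℝ) (L : levelSet a b c d) : ContinuousL1 a b c d :=
  conicMap a b c d L

/-- The inverse of `Φ` as a set-valued map, defined on the range of `Φ`, is lower semi-continuous
at the value `Φ K`: every open set meeting `Φ⁻¹(Φ K)` meets `Φ⁻¹(w)` for all `w` in the range of
`Φ` that are close enough to `Φ K`. -/
def InverseLowerSemicontinuousAt {M W : Type*} [TopologicalSpace M] [TopologicalSpace W]
    (Φ : M → W) (K : M) : Prop :=
  LowerHemicontinuousAt (fun w : Set.range Φ => Φ ⁻¹' {(w : W)}) (Set.rangeFactorization Φ K)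

/-- `K` is determined by `f_K` among the compact convex sets with non-empty interior. -/
def DeterminedByConicFun (K : ConvexBody Plane) : Prop :=
  ∀ K' : ConvexBody Plane, (interior (K' : Set Plane)).Nonempty →
    conicFun (K : Set Plane) = conicFun (K' : Set Plane) → K = K'

/-- `K` is determined by its coordinate X-rays among the compact convex sets with non-empty
interior. -/
def DeterminedByXrays (K : ConvexBody Plane) : Prop :=
  ∀ K' : ConvexBody Plane, (interior (K' : Set Plane)).Nonempty →
    SameXrays (K : Set Plane) (K' : Set Plane) → K = K'

/-!
By Fubini, `f_K (x, y)` is the sum of `∫ |x - α| Y_K(α) dα` and `∫ |y - β| X_K(β) dβ`. Second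
differences in one variable turn the kernel into a tent, so the values of `f_K` inside the bounding
box and the X-rays of `K` determine each other (`sameXrays_iff_conicFun_eq`,
`sameXrays_of_eqOn_box`).

If `K` is determined by its X-rays, the fibre of `Φ` through `K` is `{K}`. Since `Φ` is continuous
for the Hausdorff metric (`continuous_conicMap`) and the bodies inscribed in a box form a compact
space (`compactSpace_levelSet`), bodies whose value is close to `Φ K` are close to `K`.

Conversely, let `K' ≠ K` have the same X-rays. Up to exchanging `K` and `K'`, the upper boundary of
`K` lies strictly above that of `K'` over some interior abscissa `x`. Approximate `K` by inscribed
polygons `L t`, all of whose vertices are fixed except for `(x, y₀ + t)`, which lies away from `K'`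
(`exists_moving_polygons`). If `Φ⁻¹` were lower semi-continuous at `Φ K`, there would be bodies
`M t` near `K'` with `Φ (M t) = Φ (L t)`. The slice length of `M t` is affine off the abscissas of
the vertices of `L t`, being the sum of two concave functions; hence both are affine, and the
extreme points of `M t` lie in the grid spanned by the coordinates of the vertices of `L t`. So the
two ends of the slice of `M t` over `x` interpolate grid points and take the form `α + β t` with
`0 ≤ β ≤ 1` and with only finitely many pairs `(α, β)` possible. Two parameters `t` share the same
pairs; as the slice length grows at rate `1`, the upper end must have `β = 1`, which forces it to be
the moving vertex itself. Thus `M t` contains `(x, y₀ + t)` for some `t`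
(`exists_moving_vertex_mem`), although it is close to `K'`.
-/

/-! ### Slices and boundary functions -/

theorem plane_eta (p : Plane) : !₂[p 0, p 1] = p := by
  ext i; fin_cases i <;> rfl

/-- The projection of a planar set to the first coordinate axis. -/
def shadow (K : Set Plane) : Set ℝ := (fun q : Plane => q 0) '' K

/-- The vertical slice of a planar set over `x`. -/
def slice (K : Set Plane) (x : ℝ) : Set ℝ := {t : ℝ | !₂[x, t] ∈ K}

/-- The upper boundary function of a planar set; junk where the slice is empty. -/
noncomputable def upperFun (K : Set Plane) (x : ℝ) : ℝ := sSup (slice K x)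

/-- The lower boundary function of a planar set; junk where the slice is empty. -/
noncomputable def lowerFun (K : Set Plane) (x : ℝ) : ℝ := sInf (slice K x)

theorem mem_shadow_iff {K : Set Plane} {x : ℝ} : x ∈ shadow K ↔ (slice K x).Nonempty := by
  constructor
  · rintro ⟨q, hq, rfl⟩
    exact ⟨q 1, by simpa [slice, plane_eta] using hq⟩
  · rintro ⟨t, ht⟩
    exact ⟨_, ht, rfl⟩

theorem continuous_vert (x : ℝ) : Continuous fun t : ℝ => (!₂[x, t] : Plane) := by
  fun_prop

theorem continuous_coord (i : Fin 2) : Continuous fun q : Plane => q i := by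
  fun_prop

theorem combo_mk (s t x y x' y' : ℝ) :
    s • (!₂[x, y] : Plane) + t • (!₂[x', y'] : Plane) = !₂[s * x + t * x', s * y + t * y'] := by
  ext i; fin_cases i <;> simp

theorem combo_eq (s t : ℝ) (p q : Plane) :
    s • p + t • q = !₂[s * p 0 + t * q 0, s * p 1 + t * q 1] := by
  ext i; fin_cases i <;> simp

theorem isCompact_slice {K : Set Plane} (hK : IsCompact K) (x : ℝ) : IsCompact (slice K x) := by
  refine Metric.isCompact_of_isClosed_isBounded (hK.isClosed.preimage (continuous_vert x)) ?_
  refine ((hK.image (continuous_coord 1)).isBounded).subset ?_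
  intro t ht
  exact ⟨_, ht, by simp⟩

theorem convex_slice {K : Set Plane} (hK : Convex ℝ K) (x : ℝ) : Convex ℝ (slice K x) := by
  intro t ht u hu r s hr hs hrs
  have := hK ht hu hr hs hrs
  rw [combo_mk, ← add_mul, hrs, one_mul] at this
  exact this

namespace ConvexBody
variable {K : ConvexBody Plane} {a b x y : ℝ}

theorem slice_nonempty (h : shadow K = Set.Icc a b) (hx : x ∈ Set.Icc a b) :
    (slice K x).Nonempty := by
  rw [← mem_shadow_iff, h]; exact hx

theorem slice_eq (h : shadow K = Set.Icc a b) (hx : x ∈ Set.Icc a b) :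
    slice K x = Set.Icc (lowerFun K x) (upperFun K x) :=
  eq_Icc_of_connected_compact
    ⟨slice_nonempty h hx, (convex_slice K.convex x).isPreconnected⟩ (isCompact_slice K.isCompact x)

theorem mem_mk_iff (h : shadow K = Set.Icc a b) (hx : x ∈ Set.Icc a b) :
    !₂[x, y] ∈ K ↔ lowerFun K x ≤ y ∧ y ≤ upperFun K x := by
  change y ∈ slice K x ↔ _
  rw [slice_eq h hx, Set.mem_Icc]

theorem lowerFun_le_upperFun (h : shadow K = Set.Icc a b) (hx : x ∈ Set.Icc a b) :
    lowerFun K x ≤ upperFun K x := by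
  have := slice_nonempty h hx
  rw [slice_eq h hx] at this
  exact Set.nonempty_Icc.1 this

theorem upperFun_mem (h : shadow K = Set.Icc a b) (hx : x ∈ Set.Icc a b) : !₂[x, upperFun K x] ∈ K :=
  (mem_mk_iff h hx).2 ⟨lowerFun_le_upperFun h hx, le_rfl⟩

theorem lowerFun_mem (h : shadow K = Set.Icc a b) (hx : x ∈ Set.Icc a b) : !₂[x, lowerFun K x] ∈ K :=
  (mem_mk_iff h hx).2 ⟨le_rfl, lowerFun_le_upperFun h hx⟩

theorem mem_shadow {p : Plane} (h : shadow K = Set.Icc a b) (hp : p ∈ K) : p 0 ∈ Set.Icc a b := by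
  rw [← h]; exact ⟨p, hp, rfl⟩

theorem mem_iff {p : Plane} (h : shadow K = Set.Icc a b) :
    p ∈ K ↔ p 0 ∈ Set.Icc a b ∧ lowerFun K (p 0) ≤ p 1 ∧ p 1 ≤ upperFun K (p 0) := by
  constructor
  · intro hp
    have hx := mem_shadow h hp
    refine ⟨hx, (mem_mk_iff h hx).1 ?_⟩
    rwa [plane_eta]
  · rintro ⟨hx, hy⟩
    have := (mem_mk_iff h hx).2 hy
    rwa [plane_eta] at this

theorem concaveOn_upperFun (h : shadow K = Set.Icc a b) : ConcaveOn ℝ (Set.Icc a b) (upperFun K) := by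
  refine ⟨convex_Icc a b, fun x hx y hy r s hr hs hrs => ?_⟩
  have := K.convex (upperFun_mem h hx) (upperFun_mem h hy) hr hs hrs
  rw [combo_mk] at this
  exact ((mem_mk_iff h (convex_Icc a b hx hy hr hs hrs)).1 this).2

theorem convexOn_lowerFun (h : shadow K = Set.Icc a b) : ConvexOn ℝ (Set.Icc a b) (lowerFun K) := by
  refine ⟨convex_Icc a b, fun x hx y hy r s hr hs hrs => ?_⟩
  have := K.convex (lowerFun_mem h hx) (lowerFun_mem h hy) hr hs hrs
  rw [combo_mk] at this
  exact ((mem_mk_iff h (convex_Icc a b hx hy hr hs hrs)).1 this).1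

theorem xrayY_eq (h : shadow K = Set.Icc a b) (hx : x ∈ Set.Icc a b) :
    xrayY K x = ENNReal.ofReal (upperFun K x - lowerFun K x) := by
  change volume (slice K x) = _
  rw [slice_eq h hx, Real.volume_Icc]

theorem xrayY_eq_zero (h : shadow K = Set.Icc a b) (hx : x ∉ Set.Icc a b) : xrayY K x = 0 := by
  change volume (slice K x) = _
  rw [← h, mem_shadow_iff, Set.not_nonempty_iff_eq_empty] at hx
  rw [hx, measure_empty]

theorem toReal_xrayY (h : shadow K = Set.Icc a b) (hx : x ∈ Set.Icc a b) :
    (xrayY K x).toReal = upperFun K x - lowerFun K x := by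
  rw [xrayY_eq h hx, ENNReal.toReal_ofReal (sub_nonneg.2 (lowerFun_le_upperFun h hx))]

theorem xrayY_ne_top (x : ℝ) : xrayY K x ≠ ⊤ :=
  (isCompact_slice K.isCompact x).measure_lt_top.ne

theorem continuousOn_upperFun (h : shadow K = Set.Icc a b) : ContinuousOn (upperFun K) (Set.Ioo a b) := by
  rw [← interior_Icc]; exact (concaveOn_upperFun h).continuousOn_interior

theorem continuousOn_lowerFun (h : shadow K = Set.Icc a b) : ContinuousOn (lowerFun K) (Set.Ioo a b) := by
  rw [← interior_Icc]; exact (convexOn_lowerFun h).continuousOn_interior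

/-- The X-ray of a convex body is continuous away from the endpoints of the shadow. -/
theorem continuousAt_xrayY (h : shadow K = Set.Icc a b) (hxa : x ≠ a) (hxb : x ≠ b) :
    ContinuousAt (fun x => (xrayY K x).toReal) x := by
  by_cases hx : x ∈ Set.Icc a b
  · have hx' : x ∈ Set.Ioo a b := ⟨lt_of_le_of_ne hx.1 hxa.symm, lt_of_le_of_ne hx.2 hxb⟩
    have hn : Set.Ioo a b ∈ nhds x := isOpen_Ioo.mem_nhds hx'
    have h1 := ((continuousOn_upperFun h).sub (continuousOn_lowerFun h)).continuousAt hn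
    refine h1.congr ?_
    filter_upwards [hn] with z hz
    exact (toReal_xrayY h (Set.Ioo_subset_Icc_self hz)).symm
  · have hn : (Set.Icc a b)ᶜ ∈ nhds x := isClosed_Icc.isOpen_compl.mem_nhds hx
    refine (continuousAt_const (y := (0 : ℝ))).congr ?_
    filter_upwards [hn] with z hz
    rw [xrayY_eq_zero h hz, ENNReal.toReal_zero]

theorem exists_shadow_eq (K : ConvexBody Plane) : ∃ a b, a ≤ b ∧ shadow K = Set.Icc a b := by
  have hc : IsCompact (shadow (K : Set Plane)) := K.isCompact.image (continuous_coord 0)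
  have hne : (shadow (K : Set Plane)).Nonempty := K.nonempty.image _
  have hp : IsPreconnected (shadow (K : Set Plane)) :=
    K.convex.isPreconnected.image _ (continuous_coord 0).continuousOn
  have := eq_Icc_of_connected_compact ⟨hne, hp⟩ hc
  refine ⟨_, _, ?_, this⟩
  rw [this] at hne
  exact Set.nonempty_Icc.1 hne

end ConvexBody

/-- The reflection of the plane exchanging the two coordinates. -/
noncomputable def swapEquiv : Plane ≃ₗᵢ[ℝ] Plane :=
  LinearIsometryEquiv.piLpCongrLeft 2 ℝ ℝ (Equiv.swap (0 : Fin 2) 1)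

theorem swapEquiv_apply (p : Plane) : swapEquiv p = !₂[p 1, p 0] := by
  ext i
  fin_cases i <;> simp [swapEquiv, LinearIsometryEquiv.piLpCongrLeft_apply]

theorem swapEquiv_swapEquiv (p : Plane) : swapEquiv (swapEquiv p) = p := by
  rw [swapEquiv_apply, swapEquiv_apply]; simp [plane_eta]

/-- The mirror image of a convex body under the exchange of coordinates. -/
noncomputable def swapBody (K : ConvexBody Plane) : ConvexBody Plane where
  carrier := swapEquiv ⁻¹' K
  convex' := K.convex.linear_preimage swapEquiv.toLinearEquiv.toLinearMap
  isCompact' := by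
    rw [← LinearIsometryEquiv.coe_toHomeomorph, Homeomorph.isCompact_preimage]
    exact K.isCompact
  nonempty' := K.nonempty.preimage swapEquiv.surjective

theorem coe_swapBody (K : ConvexBody Plane) : (swapBody K : Set Plane) = swapEquiv ⁻¹' K := rfl

theorem mem_swapBody {K : ConvexBody Plane} {p : Plane} : p ∈ swapBody K ↔ !₂[p 1, p 0] ∈ K := by
  rw [← swapEquiv_apply]; rfl

theorem xrayY_swapBody (K : ConvexBody Plane) : xrayY (swapBody K) = xrayX K := by
  ext x
  unfold xrayX xrayY
  congr 1
  ext t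
  exact mem_swapBody

theorem shadow_swapBody (K : ConvexBody Plane) :
    shadow (swapBody K) = (fun q : Plane => q 1) '' K := by
  ext x
  constructor
  · rintro ⟨q, hq, rfl⟩
    exact ⟨_, mem_swapBody.1 hq, by simp⟩
  · rintro ⟨q, hq, rfl⟩
    refine ⟨!₂[q 1, q 0], ?_, by simp⟩
    rw [SetLike.mem_coe, mem_swapBody]; simpa [plane_eta] using hq

/-- Membership in the level set of a non-empty box amounts to prescribing both shadows. -/
theorem mem_levelSet_iff {K : ConvexBody Plane} {a b c d : ℝ} (hab : a ≤ b) (hcd : c ≤ d) :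
    K ∈ levelSet a b c d ↔ shadow K = Set.Icc a b ∧ shadow (swapBody K) = Set.Icc c d := by
  rw [shadow_swapBody]
  constructor
  · intro h
    change prodProj (K : Set Plane) = box a b c d at h
    obtain ⟨k, hk⟩ := K.nonempty
    constructor
    · ext x
      have h1 := Set.ext_iff.1 h !₂[x, k 1]
      have h2 := Set.ext_iff.1 h !₂[x, c]
      have h3 := Set.ext_iff.1 h k
      simp only [prodProj, box, Set.mem_ofPred_eq, shadow, Set.mem_image] at *
      simp at h1 h2 h3 ⊢
      constructor
      · rintro ⟨q, hq, rfl⟩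
        exact (h1.1 ⟨⟨q, hq, rfl⟩, ⟨k, hk, rfl⟩⟩).1
      · intro hx
        exact (h2.2 ⟨hx, hcd⟩).1
    · ext x
      have h1 := Set.ext_iff.1 h !₂[k 0, x]
      have h2 := Set.ext_iff.1 h !₂[a, x]
      simp only [prodProj, box, Set.mem_ofPred_eq, Set.mem_image] at *
      simp at h1 h2 ⊢
      constructor
      · rintro ⟨q, hq, rfl⟩
        exact (h1.1 ⟨⟨k, hk, rfl⟩, ⟨q, hq, rfl⟩⟩).2
      · intro hx
        exact (h2.2 ⟨hab, hx⟩).2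
  · rintro ⟨h1, h2⟩
    change prodProj (K : Set Plane) = box a b c d
    unfold shadow at h1
    rw [prodProj, box, h1, h2]

theorem le_of_mem_levelSet {K : ConvexBody Plane} {a b c d : ℝ} (h : K ∈ levelSet a b c d) :
    a ≤ b ∧ c ≤ d := by
  obtain ⟨k, hk⟩ := K.nonempty
  have : k ∈ prodProj (K : Set Plane) := ⟨⟨k, hk, rfl⟩, ⟨k, hk, rfl⟩⟩
  rw [show prodProj (K : Set Plane) = box a b c d from h] at this
  exact ⟨this.1.1.trans this.1.2, this.2.1.trans this.2.2⟩

theorem shadow_of_mem_levelSet {K : ConvexBody Plane} {a b c d : ℝ} (h : K ∈ levelSet a b c d) :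
    shadow K = Set.Icc a b :=
  ((mem_levelSet_iff (le_of_mem_levelSet h).1 (le_of_mem_levelSet h).2).1 h).1

theorem shadow_swapBody_of_mem_levelSet {K : ConvexBody Plane} {a b c d : ℝ}
    (h : K ∈ levelSet a b c d) : shadow (swapBody K) = Set.Icc c d :=
  ((mem_levelSet_iff (le_of_mem_levelSet h).1 (le_of_mem_levelSet h).2).1 h).2

theorem subset_box_of_mem_levelSet {K : ConvexBody Plane} {a b c d : ℝ}
    (h : K ∈ levelSet a b c d) : (K : Set Plane) ⊆ box a b c d := by
  rw [← show prodProj (K : Set Plane) = box a b c d from h]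
  exact fun k hk => ⟨⟨k, hk, rfl⟩, ⟨k, hk, rfl⟩⟩

/-- A body with interior points has non-degenerate shadow. -/
theorem shadow_lt_of_interior {K : ConvexBody Plane} {a b : ℝ} (h : shadow K = Set.Icc a b)
    (hK : (interior (K : Set Plane)).Nonempty) : a < b := by
  obtain ⟨z, hz⟩ := hK
  by_contra hab
  have hsub : (K : Set Plane) ⊆ {p | p 0 = a} := fun p hp => by
    have := ConvexBody.mem_shadow h hp
    exact le_antisymm (this.2.trans (not_lt.1 hab)) this.1
  have hcont : Continuous fun t : ℝ => (!₂[t, z 1] : Plane) := by fun_prop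
  have hn : ∀ᶠ t in nhds (z 0), !₂[t, z 1] ∈ (K : Set Plane) := by
    refine hcont.continuousAt.eventually ?_
    simp only [plane_eta]
    exact mem_interior_iff_mem_nhds.1 hz
  have h2 : ∀ᶠ t in nhds (z 0), t = a := hn.mono fun t ht => by simpa using hsub ht
  have h3 := h2.self_of_nhds
  subst h3
  exact (infinite_of_mem_nhds (z 0) h2) (Set.finite_singleton (z 0))

theorem interior_swapBody_nonempty {K : ConvexBody Plane} (hK : (interior (K : Set Plane)).Nonempty) :
    (interior (swapBody K : Set Plane)).Nonempty := by
  rw [coe_swapBody, ← LinearIsometryEquiv.coe_toHomeomorph, ← Homeomorph.preimage_interior]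
  exact hK.preimage swapEquiv.surjective

/-! ### Conic functions and X-rays -/

/-- The identification of the Euclidean plane with `ℝ × ℝ` as a measurable equivalence. -/
def planeProd : Plane ≃ᵐ ℝ × ℝ :=
  (MeasurableEquiv.toLp 2 (Fin 2 → ℝ)).symm.trans MeasurableEquiv.finTwoArrow

theorem planeProd_symm_apply (z : ℝ × ℝ) : planeProd.symm z = !₂[z.1, z.2] := by
  ext i; fin_cases i <;> rfl

theorem measurePreserving_planeProd : MeasurePreserving planeProd :=
  (volume_preserving_finTwoArrow ℝ).comp
    (EuclideanSpace.volume_preserving_symm_measurableEquiv_toLp (Fin 2))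

theorem indicator_planeProd_symm (K : Set Plane) (g : ℝ → ℝ) (x y : ℝ) :
    K.indicator (fun q => g (q 0)) (planeProd.symm (x, y)) =
      (slice K x).indicator (fun _ => g x) y := by
  rw [planeProd_symm_apply]
  by_cases h : !₂[x, y] ∈ K
  · rw [Set.indicator_of_mem h, Set.indicator_of_mem (show y ∈ slice K x from h)]; simp
  · rw [Set.indicator_of_notMem h, Set.indicator_of_notMem (show y ∉ slice K x from h)]

theorem integrable_indicator_planeProd (K : ConvexBody Plane) {g : ℝ → ℝ} (hg : Continuous g) :
    Integrable (fun z => (K : Set Plane).indicator (fun q => g (q 0)) (planeProd.symm z))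
      (volume.prod volume) := by
  have h1 : IntegrableOn (fun q : Plane => g (q 0)) K :=
    (hg.comp (continuous_coord 0)).continuousOn.integrableOn_compact K.isCompact
  have h2 := (integrable_indicator_iff K.isCompact.measurableSet).2 h1
  exact (measurePreserving_planeProd.symm planeProd).integrable_comp_of_integrable h2

theorem integral_slice_indicator (K : ConvexBody Plane) (g : ℝ → ℝ) (x : ℝ) :
    ∫ y, (K : Set Plane).indicator (fun q => g (q 0)) (planeProd.symm (x, y)) =
      g x * (xrayY K x).toReal := by
  simp_rw [indicator_planeProd_symm]
  rw [integral_indicator (isCompact_slice K.isCompact x).measurableSet, setIntegral_const,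
    smul_eq_mul, mul_comm]
  rfl

theorem integrable_mul_xrayY (K : ConvexBody Plane) {g : ℝ → ℝ} (hg : Continuous g) :
    Integrable fun x => g x * (xrayY K x).toReal := by
  have := (integrable_indicator_planeProd K hg).integral_prod_left
  simpa only [integral_slice_indicator] using this

/-- Fubini: integrating a function of the first coordinate over `K` weighs it by the X-ray. -/
theorem setIntegral_fst (K : ConvexBody Plane) {g : ℝ → ℝ} (hg : Continuous g) :
    ∫ q in (K : Set Plane), g (q 0) = ∫ x, g x * (xrayY K x).toReal := by
  rw [← integral_indicator K.isCompact.measurableSet,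
    ← (measurePreserving_planeProd.symm planeProd).integral_comp planeProd.symm.measurableEmbedding]
  rw [Measure.volume_eq_prod, integral_prod _ (integrable_indicator_planeProd K hg)]
  simp only [integral_slice_indicator]

theorem setIntegral_swapBody (K : ConvexBody Plane) (g : Plane → ℝ) :
    ∫ q in (swapBody K : Set Plane), g q = ∫ q in (K : Set Plane), g !₂[q 1, q 0] := by
  have h := swapEquiv.measurePreserving.setIntegral_preimage_emb
    swapEquiv.toHomeomorph.measurableEmbedding (fun q => g (swapEquiv q)) (K : Set Plane)
  rw [coe_swapBody]
  simp only [swapEquiv_swapEquiv] at h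
  rw [h]
  simp only [swapEquiv_apply]

theorem setIntegral_snd (K : ConvexBody Plane) {g : ℝ → ℝ} (hg : Continuous g) :
    ∫ q in (K : Set Plane), g (q 1) = ∫ y, g y * (xrayX K y).toReal := by
  rw [← xrayY_swapBody, ← setIntegral_fst _ hg, setIntegral_swapBody]
  simp

theorem conicFun_eq (K : ConvexBody Plane) (p : Plane) :
    conicFun K p = (∫ x, |p 0 - x| * (xrayY K x).toReal) + ∫ y, |p 1 - y| * (xrayX K y).toReal := by
  rw [← setIntegral_fst K (g := fun x => |p 0 - x|) (by fun_prop),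
    ← setIntegral_snd K (g := fun x => |p 1 - x|) (by fun_prop), conicFun, integral_add]
  · exact (Continuous.continuousOn (by fun_prop)).integrableOn_compact K.isCompact
  · exact (Continuous.continuousOn (by fun_prop)).integrableOn_compact K.isCompact

theorem conicFun_eq_of_sameXrays {K L : ConvexBody Plane} (h : SameXrays K L) :
    conicFun K = conicFun L := by
  ext p
  rw [conicFun_eq, conicFun_eq]
  congr 1
  · exact integral_congr_ae (h.1.mono fun x hx => by simp only [hx])
  · exact integral_congr_ae (h.2.mono fun x hx => by simp only [hx])

theorem conicFun_swapBody (K : ConvexBody Plane) (p : Plane) :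
    conicFun (swapBody K) p = conicFun K !₂[p 1, p 0] := by
  unfold conicFun
  rw [setIntegral_swapBody]
  simp only [Matrix.cons_val_zero, Matrix.cons_val_one, add_comm]

/-- The second difference of the conic function in the horizontal direction averages the X-ray
with a tent-shaped weight. -/
theorem conicFun_second_difference (K : ConvexBody Plane) (x y : ℝ) {s : ℝ} (hs : 0 ≤ s) :
    conicFun K !₂[x + s, y] + conicFun K !₂[x - s, y] - 2 * conicFun K !₂[x, y] =
      2 * ∫ z, max 0 (s - |x - z|) * (xrayY K z).toReal := by
  have hI (r : ℝ) : Integrable fun z => |r - z| * (xrayY K z).toReal :=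
    integrable_mul_xrayY K (by fun_prop)
  simp only [conicFun_eq, Matrix.cons_val_zero, Matrix.cons_val_one]
  have key : ∀ z : ℝ, 2 * (max 0 (s - |x - z|) * (xrayY K z).toReal) =
      |x + s - z| * (xrayY K z).toReal + |x - s - z| * (xrayY K z).toReal -
        2 * (|x - z| * (xrayY K z).toReal) := by
    intro z
    have : 2 * max 0 (s - |x - z|) = |x + s - z| + |x - s - z| - 2 * |x - z| := by
      rcases max_cases 0 (s - |x - z|) with ⟨h, h'⟩ | ⟨h, h'⟩ <;>
      rcases abs_cases (x - z) with ⟨h1, h1'⟩ | ⟨h1, h1'⟩ <;>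
      rcases abs_cases (x + s - z) with ⟨h2, h2'⟩ | ⟨h2, h2'⟩ <;>
      rcases abs_cases (x - s - z) with ⟨h3, h3'⟩ | ⟨h3, h3'⟩ <;> linarith
    rw [← mul_assoc, this]; ring
  rw [← integral_const_mul, integral_congr_ae (Filter.Eventually.of_forall key),
    integral_sub (by exact (hI _).add (hI _)) ((hI _).const_mul 2), integral_add (hI _) (hI _),
    integral_const_mul]
  ring

/-- If one X-ray were larger at `x`, a narrow tent around `x` would tell the second differences of
the conic functions apart. -/
theorem xrayY_le_of_conicFun_eq {K L : ConvexBody Plane} {x y δ : ℝ} (hδ : 0 < δ)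
    (h : ∀ z ∈ Set.Icc (x - δ) (x + δ), conicFun K !₂[z, y] = conicFun L !₂[z, y])
    (hK : ContinuousAt (fun z => (xrayY K z).toReal) x)
    (hL : ContinuousAt (fun z => (xrayY L z).toReal) x) :
    (xrayY K x).toReal ≤ (xrayY L x).toReal := by
  by_contra! hlt
  have hev : ∀ᶠ z in nhds x, (xrayY L z).toReal < (xrayY K z).toReal := hL.eventually_lt hK hlt
  obtain ⟨ε, hε, hball⟩ := Metric.eventually_nhds_iff.1 hev
  set s := min ε δ with hs
  have hs0 : 0 < s := lt_min hε hδ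
  have hsd : s ≤ δ := min_le_right _ _
  have e1 := conicFun_second_difference K x y hs0.le
  have e2 := conicFun_second_difference L x y hs0.le
  rw [h _ ⟨by linarith, by linarith⟩, h _ ⟨by linarith, by linarith⟩,
    h _ ⟨by linarith, by linarith⟩, e2] at e1
  have hint (M : ConvexBody Plane) : Integrable fun z => max 0 (s - |x - z|) * (xrayY M z).toReal :=
    integrable_mul_xrayY M (by fun_prop)
  have hzero : ∫ z, (max 0 (s - |x - z|) * (xrayY K z).toReal -
      max 0 (s - |x - z|) * (xrayY L z).toReal) = 0 := by
    rw [integral_sub (hint K) (hint L)]; linarith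
  have hpos : 0 < ∫ z, (max 0 (s - |x - z|) * (xrayY K z).toReal -
      max 0 (s - |x - z|) * (xrayY L z).toReal) := by
    rw [integral_pos_iff_support_of_nonneg _ (by exact (hint K).sub (hint L))]
    · refine lt_of_lt_of_le ?_ (measure_mono (s := Set.Ioo (x - s) (x + s)) ?_)
      · rw [Real.volume_Ioo, ENNReal.ofReal_pos]; linarith
      · intro z hz
        have hz' : |x - z| < s := by rw [abs_lt]; constructor <;> linarith [hz.1, hz.2]
        have hlt' := hball (y := z) (by
          rw [Real.dist_eq, abs_sub_comm]; exact hz'.trans_le (min_le_left _ _))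
        rw [Function.mem_support, ← mul_sub, max_eq_right (by linarith)]
        exact (mul_pos (by linarith) (by linarith)).ne'
    · intro z
      simp only [Pi.zero_apply, ← mul_sub]
      rcases lt_or_ge |x - z| s with hz | hz
      · have hlt' := hball (y := z) (by
          rw [Real.dist_eq, abs_sub_comm]; exact hz.trans_le (min_le_left _ _))
        exact mul_nonneg (le_max_left _ _) (by linarith)
      · rw [max_eq_left (by linarith), zero_mul]
  linarith

/-- The conic function near a horizontal segment determines the X-ray at interior points of the
segment at which the X-rays are continuous. -/
theorem xrayY_eq_of_conicFun_eq {K L : ConvexBody Plane} {x y δ : ℝ} (hδ : 0 < δ)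
    (h : ∀ z ∈ Set.Icc (x - δ) (x + δ), conicFun K !₂[z, y] = conicFun L !₂[z, y])
    (hK : ContinuousAt (fun z => (xrayY K z).toReal) x)
    (hL : ContinuousAt (fun z => (xrayY L z).toReal) x) :
    xrayY K x = xrayY L x :=
  (ENNReal.toReal_eq_toReal_iff' (K.xrayY_ne_top x) (L.xrayY_ne_top x)).1 <| le_antisymm
    (xrayY_le_of_conicFun_eq hδ h hK hL)
    (xrayY_le_of_conicFun_eq hδ (fun z hz => (h z hz).symm) hL hK)

theorem ae_xrayY_eq_of_conicFun_eq {K L : ConvexBody Plane} (h : conicFun K = conicFun L) :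
    ∀ᵐ x : ℝ, xrayY K x = xrayY L x := by
  obtain ⟨a, b, -, hK⟩ := K.exists_shadow_eq
  obtain ⟨a', b', -, hL⟩ := L.exists_shadow_eq
  have hfin : ({a, b, a', b'} : Set ℝ).Finite := Set.toFinite _
  filter_upwards [compl_mem_ae_iff.2 (hfin.measure_zero _)] with x hx
  simp only [Set.mem_compl_iff, Set.mem_insert_iff, Set.mem_singleton_iff, not_or] at hx
  exact xrayY_eq_of_conicFun_eq (y := 0) one_pos (fun z _ => by rw [h])
    (ConvexBody.continuousAt_xrayY hK hx.1 hx.2.1)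
    (ConvexBody.continuousAt_xrayY hL hx.2.2.1 hx.2.2.2)

theorem sameXrays_iff_conicFun_eq {K L : ConvexBody Plane} :
    SameXrays K L ↔ conicFun K = conicFun L := by
  refine ⟨conicFun_eq_of_sameXrays, fun h => ⟨ae_xrayY_eq_of_conicFun_eq h, ?_⟩⟩
  simp only [← xrayY_swapBody]
  apply ae_xrayY_eq_of_conicFun_eq
  ext p
  rw [conicFun_swapBody, conicFun_swapBody, h]

theorem determinedByXrays_iff_determinedByConicFun (K : ConvexBody Plane) :
    DeterminedByXrays K ↔ DeterminedByConicFun K := by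
  unfold DeterminedByXrays DeterminedByConicFun
  simp only [sameXrays_iff_conicFun_eq]

theorem xrayY_eq_of_eqOn_box {K L : ConvexBody Plane} {a b c d : ℝ}
    (hK : shadow K = Set.Icc a b) (hL : shadow L = Set.Icc a b) (hcd : c < d)
    (h : ∀ p, p 0 ∈ Set.Ioo a b → p 1 ∈ Set.Ioo c d → conicFun K p = conicFun L p)
    {x : ℝ} (hxa : x ≠ a) (hxb : x ≠ b) : xrayY K x = xrayY L x := by
  by_cases hx : x ∈ Set.Icc a b
  · have h1 : a < x := lt_of_le_of_ne hx.1 hxa.symm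
    have h2 : x < b := lt_of_le_of_ne hx.2 hxb
    have hδ : 0 < min (x - a) (b - x) / 2 := by
      have : 0 < min (x - a) (b - x) := lt_min (by linarith) (by linarith)
      linarith
    refine xrayY_eq_of_conicFun_eq (y := (c + d) / 2) hδ (fun z hz => h _ ?_ ?_)
      (ConvexBody.continuousAt_xrayY hK hxa hxb) (ConvexBody.continuousAt_xrayY hL hxa hxb)
    · have := min_le_left (x - a) (b - x)
      have := min_le_right (x - a) (b - x)
      simp only [Matrix.cons_val_zero]
      constructor <;> linarith [hz.1, hz.2]
    · simp only [Matrix.cons_val_one, Matrix.cons_val_zero]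
      constructor <;> linarith
  · rw [ConvexBody.xrayY_eq_zero hK hx, ConvexBody.xrayY_eq_zero hL hx]

/-- Two bodies inscribed in the same box have the same X-rays once their conic functions agree
inside the box. -/
theorem sameXrays_of_eqOn_box {K L : ConvexBody Plane} {a b c d : ℝ} (hab : a < b) (hcd : c < d)
    (hK : K ∈ levelSet a b c d) (hL : L ∈ levelSet a b c d)
    (h : ∀ p, p 0 ∈ Set.Ioo a b → p 1 ∈ Set.Ioo c d → conicFun K p = conicFun L p) :
    SameXrays K L := by
  have hfin (r s : ℝ) : ({r, s} : Set ℝ)ᶜ ∈ ae (volume : Measure ℝ) :=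
    compl_mem_ae_iff.2 ((Set.toFinite _).measure_zero _)
  constructor
  · filter_upwards [hfin a b] with x hx
    simp only [Set.mem_compl_iff, Set.mem_insert_iff, Set.mem_singleton_iff, not_or] at hx
    exact xrayY_eq_of_eqOn_box (shadow_of_mem_levelSet hK) (shadow_of_mem_levelSet hL) hcd h
      hx.1 hx.2
  · filter_upwards [hfin c d] with x hx
    simp only [Set.mem_compl_iff, Set.mem_insert_iff, Set.mem_singleton_iff, not_or] at hx
    rw [← xrayY_swapBody, ← xrayY_swapBody]
    refine xrayY_eq_of_eqOn_box (shadow_swapBody_of_mem_levelSet hK)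
      (shadow_swapBody_of_mem_levelSet hL) hab (fun p hp0 hp1 => ?_) hx.1 hx.2
    rw [conicFun_swapBody, conicFun_swapBody]
    exact h _ (by simpa using hp1) (by simpa using hp0)

/-- The X-ray is positive over the interior of the shadow of a body with interior points. -/
theorem lowerFun_lt_upperFun {K : ConvexBody Plane} {a b x : ℝ} (hK : shadow K = Set.Icc a b)
    (hi : (interior (K : Set Plane)).Nonempty) (hx : x ∈ Set.Ioo a b) : lowerFun K x < upperFun K x := by
  obtain ⟨z, hz⟩ := hi
  have hx' := Set.Ioo_subset_Icc_self hx
  have hab : a ≤ b := (hx.1.trans hx.2).le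
  -- `x` is a proper convex combination of the abscissa of an interior point and of an endpoint
  obtain ⟨e, he, s, hs0, hs1, hxe⟩ : ∃ e ∈ Set.Icc a b, ∃ s : ℝ, 0 < s ∧ s ≤ 1 ∧
      x = s * z 0 + (1 - s) * e := by
    have hzab := ConvexBody.mem_shadow hK (interior_subset hz)
    rcases lt_trichotomy x (z 0) with h | h | h
    · refine ⟨a, ⟨le_rfl, hab⟩, (x - a) / (z 0 - a), div_pos (by linarith [hx.1])
        (by linarith [hx.1]), (div_le_one (by linarith [hx.1])).2 (by linarith), ?_⟩
      have : z 0 - a ≠ 0 := by linarith [hx.1]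
      field_simp; ring
    · exact ⟨a, ⟨le_rfl, hab⟩, 1, one_pos, le_rfl, by linarith⟩
    · refine ⟨b, ⟨hab, le_rfl⟩, (b - x) / (b - z 0), div_pos (by linarith [hx.2])
        (by linarith [hx.2]), (div_le_one (by linarith [hx.2])).2 (by linarith), ?_⟩
      have : b - z 0 ≠ 0 := by linarith [hx.2]
      field_simp; ring
  have hcont : Continuous fun t : ℝ => (!₂[z 0, t] : Plane) := by fun_prop
  have hn : ∀ᶠ t in nhds (z 1), !₂[z 0, t] ∈ (K : Set Plane) := by
    refine hcont.continuousAt.eventually ?_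
    simp only [plane_eta]
    exact mem_interior_iff_mem_nhds.1 hz
  obtain ⟨t, ht, ht'⟩ := (hn.filter_mono nhdsWithin_le_nhds |>.and
    (self_mem_nhdsWithin (s := Set.Ioi (z 1)))).exists
  have m1 := K.convex ht (K.upperFun_mem hK he) hs0.le (sub_nonneg.2 hs1) (by ring)
  have m2 := K.convex (interior_subset hz) (K.upperFun_mem hK he) hs0.le (sub_nonneg.2 hs1) (by ring)
  rw [← plane_eta z] at m2
  rw [combo_mk, ← hxe] at m1 m2
  have h1 := ((ConvexBody.mem_mk_iff hK hx').1 m1).2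
  have h2 := ((ConvexBody.mem_mk_iff hK hx').1 m2).1
  have : s * z 1 < s * t := mul_lt_mul_of_pos_left ht' hs0
  linarith

theorem volume_pos_iff_interior_nonempty (K : ConvexBody Plane) :
    0 < volume (K : Set Plane) ↔ (interior (K : Set Plane)).Nonempty := by
  constructor
  · intro h
    by_contra hne
    rw [Set.not_nonempty_iff_eq_empty] at hne
    have h0 := K.convex.addHaar_frontier volume
    rw [frontier, K.isClosed.closure_eq, hne, Set.sdiff_empty] at h0
    exact h.ne' h0
  · exact fun h => Measure.measure_pos_of_nonempty_interior _ h

theorem interior_nonempty_of_sameXrays {K L : ConvexBody Plane}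
    (hK : (interior (K : Set Plane)).Nonempty) (h : SameXrays K L) :
    (interior (L : Set Plane)).Nonempty := by
  rw [← volume_pos_iff_interior_nonempty] at hK ⊢
  have h1 (M : ConvexBody Plane) : volume.real (M : Set Plane) = ∫ x, (xrayY M x).toReal := by
    have := setIntegral_fst M (g := fun _ => 1) continuous_const
    simpa using this
  have h2 : volume.real (L : Set Plane) = volume.real (K : Set Plane) := by
    rw [h1, h1]
    exact integral_congr_ae (h.1.mono fun x hx => by simp only [hx])
  have h3 : 0 < volume.real (K : Set Plane) := ENNReal.toReal_pos hK.ne' K.isCompact.measure_lt_top.ne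
  rw [← h2] at h3
  exact (ENNReal.toReal_pos_iff.1 h3).1

/-! ### Continuity of the conic function in the Hausdorff metric -/

/-- A convex body within Hausdorff distance less than `r` of `K` contains the centre of every ball
of radius `r` in `K`; otherwise the ball sticks out too far in the direction away from it. -/
theorem mem_of_ball_subset {K L : ConvexBody Plane} {z : Plane} {r : ℝ}
    (hz : Metric.ball z r ⊆ K) (h : dist K L < r) : z ∈ L := by
  by_contra hzL
  obtain ⟨p, hp, hmin⟩ := exists_norm_eq_iInf_of_complete_convex L.nonempty
    L.isCompact.isComplete L.convex z
  rw [norm_eq_iInf_iff_real_inner_le_zero L.convex hp] at hmin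
  have hv : z - p ≠ 0 := fun h0 => hzL (by rw [sub_eq_zero.1 h0]; exact hp)
  have hv' : 0 < ‖z - p‖ := norm_pos_iff.2 hv
  obtain ⟨r', hr', hr'r⟩ := exists_between h
  have hr'0 : 0 < r' := dist_nonneg.trans_lt hr'
  -- the point of the ball farthest in the direction away from `L`
  set q := z + (r' / ‖z - p‖) • (z - p) with hq
  have hqK : q ∈ (K : Set Plane) := by
    apply hz
    rw [Metric.mem_ball, dist_eq_norm, hq, add_sub_cancel_left, norm_smul, Real.norm_eq_abs,
      abs_of_pos (div_pos hr'0 hv'), div_mul_cancel₀ _ hv'.ne']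
    exact hr'r
  obtain ⟨w, hw, hqw⟩ := Metric.exists_dist_lt_of_hausdorffDist_lt hqK hr'
    ConvexBody.hausdorffEDist_ne_top
  have h1 := hmin w hw
  have h2 : inner ℝ (z - p) (q - w) ≤ ‖z - p‖ * ‖q - w‖ := real_inner_le_norm _ _
  have h3 : q - w = (z - p) + (r' / ‖z - p‖) • (z - p) - (w - p) := by rw [hq]; abel
  rw [dist_eq_norm] at hqw
  have h4 : inner ℝ (z - p) (q - w) = ‖z - p‖ ^ 2 + r' * ‖z - p‖ - inner ℝ (z - p) (w - p) := by
    rw [h3, inner_sub_right, inner_add_right, inner_smul_right, real_inner_self_eq_norm_sq]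
    field_simp
  nlinarith [mul_lt_mul_of_pos_left hqw hv']

theorem eventually_mem_of_mem_interior {K : ConvexBody Plane} {z : Plane}
    (hz : z ∈ interior (K : Set Plane)) : ∀ᶠ L in nhds K, z ∈ L := by
  obtain ⟨r, hr, hball⟩ := Metric.mem_nhds_iff.1 (mem_interior_iff_mem_nhds.1 hz)
  filter_upwards [Metric.ball_mem_nhds K hr] with L hL
  exact mem_of_ball_subset hball (by rwa [dist_comm])

theorem eventually_notMem_of_notMem {K : ConvexBody Plane} {z : Plane} (hz : z ∉ K) :
    ∀ᶠ L in nhds K, z ∉ L := by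
  obtain ⟨r, hr, hball⟩ := Metric.mem_nhds_iff.1 (K.isClosed.isOpen_compl.mem_nhds hz)
  filter_upwards [Metric.ball_mem_nhds K hr] with L hL hzL
  obtain ⟨w, hw, hzw⟩ := Metric.exists_dist_lt_of_hausdorffDist_lt hzL hL
    ConvexBody.hausdorffEDist_ne_top
  exact hball (by rwa [Metric.mem_ball, dist_comm]) hw

/-- The indicators of a body near `K` approach that of `K` off the null set `frontier K`. -/
theorem tendsto_indicator_sub (K : ConvexBody Plane) :
    ∀ᵐ q : Plane, Filter.Tendsto (fun L : ConvexBody Plane =>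
      |(L : Set Plane).indicator (fun _ => (1 : ℝ)) q -
        (K : Set Plane).indicator (fun _ => (1 : ℝ)) q|) (nhds K) (nhds 0) := by
  filter_upwards [compl_mem_ae_iff.2 (K.convex.addHaar_frontier volume)] with q hq
  apply tendsto_const_nhds.congr'
  by_cases hqK : q ∈ (K : Set Plane)
  · have hi : q ∈ interior (K : Set Plane) := by
      by_contra h
      exact hq ⟨subset_closure hqK, h⟩
    filter_upwards [eventually_mem_of_mem_interior hi] with L hL
    rw [Set.indicator_of_mem hqK, Set.indicator_of_mem (show q ∈ (L : Set Plane) from hL)]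
    simp
  · filter_upwards [eventually_notMem_of_notMem hqK] with L hL
    rw [Set.indicator_of_notMem hqK, Set.indicator_of_notMem (show q ∉ (L : Set Plane) from hL)]
    simp

theorem tendsto_setIntegral_indicator_sub (K : ConvexBody Plane) {B : Set Plane}
    (hB : IsCompact B) :
    Filter.Tendsto (fun L : ConvexBody Plane => ∫ q in B,
      |(L : Set Plane).indicator (fun _ => (1 : ℝ)) q -
        (K : Set Plane).indicator (fun _ => (1 : ℝ)) q|) (nhds K) (nhds 0) := by
  have hfin : IsFiniteMeasure (volume.restrict B) := ⟨by simpa using hB.measure_lt_top⟩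
  have h01 (L : ConvexBody Plane) (q : Plane) :
      (L : Set Plane).indicator (fun _ => (1 : ℝ)) q ∈ Set.Icc (0 : ℝ) 1 := by
    by_cases h : q ∈ (L : Set Plane) <;> simp [h]
  have := tendsto_integral_filter_of_dominated_convergence (μ := volume.restrict B)
    (l := nhds K) (f := fun _ => (0 : ℝ)) (F := fun (L : ConvexBody Plane) q =>
      |(L : Set Plane).indicator (fun _ => (1 : ℝ)) q -
        (K : Set Plane).indicator (fun _ => (1 : ℝ)) q|) (fun _ => 1) ?_ ?_ (integrable_const _) ?_
  · simpa using this
  · refine Filter.Eventually.of_forall fun L => Measurable.aestronglyMeasurable ?_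
    exact ((measurable_const.indicator L.isCompact.measurableSet).sub
      (measurable_const.indicator K.isCompact.measurableSet)).abs
  · refine Filter.Eventually.of_forall fun L => Filter.Eventually.of_forall fun q => ?_
    rw [Real.norm_eq_abs, abs_abs, abs_le]
    constructor <;> linarith [(h01 L q).1, (h01 L q).2, (h01 K q).1, (h01 K q).2]
  · exact ae_restrict_of_ae (tendsto_indicator_sub K)

theorem abs_conicFun_sub_le {a b c d : ℝ} {K L : ConvexBody Plane}
    (hK : (K : Set Plane) ⊆ box a b c d) (hL : (L : Set Plane) ⊆ box a b c d)
    {p : Plane} (hp : p ∈ box a b c d) :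
    |conicFun L p - conicFun K p| ≤ ((b - a) + (d - c)) * ∫ q in box a b c d,
      |(L : Set Plane).indicator (fun _ => (1 : ℝ)) q -
        (K : Set Plane).indicator (fun _ => (1 : ℝ)) q| := by
  have hBm := (isCompact_box a b c d).measurableSet
  have hcont : Continuous fun q : Plane => |p 0 - q 0| + |p 1 - q 1| := by fun_prop
  have hint : IntegrableOn (fun q : Plane => |p 0 - q 0| + |p 1 - q 1|) (box a b c d) :=
    hcont.continuousOn.integrableOn_compact (isCompact_box a b c d)
  have hM {M : ConvexBody Plane} (hM : (M : Set Plane) ⊆ box a b c d) :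
      conicFun M p = ∫ q in box a b c d,
        (M : Set Plane).indicator (fun q => |p 0 - q 0| + |p 1 - q 1|) q := by
    rw [setIntegral_indicator M.isCompact.measurableSet, Set.inter_eq_right.2 hM]
    rfl
  have hone (M : ConvexBody Plane) : IntegrableOn
      ((M : Set Plane).indicator (fun _ => (1 : ℝ))) (box a b c d) :=
    (integrableOn_const (isCompact_box a b c d).measure_lt_top.ne).indicator
      M.isCompact.measurableSet
  rw [hM hL, hM hK, ← integral_sub (hint.indicator L.isCompact.measurableSet)
    (hint.indicator K.isCompact.measurableSet), ← integral_const_mul]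
  refine abs_integral_le_integral_abs.trans (setIntegral_mono_on ?_ ?_ hBm fun q hq => ?_)
  · exact ((hint.indicator L.isCompact.measurableSet).sub
      (hint.indicator K.isCompact.measurableSet)).abs
  · exact (((hone L).sub (hone K)).abs).const_mul _
  · have hmul (M : ConvexBody Plane) :
        (M : Set Plane).indicator (fun q => |p 0 - q 0| + |p 1 - q 1|) q =
          (|p 0 - q 0| + |p 1 - q 1|) * (M : Set Plane).indicator (fun _ => (1 : ℝ)) q := by
      by_cases h : q ∈ (M : Set Plane) <;> simp [h]
    rw [hmul, hmul, ← mul_sub, abs_mul, abs_of_nonneg (add_nonneg (abs_nonneg _) (abs_nonneg _))]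
    refine mul_le_mul_of_nonneg_right ?_ (abs_nonneg _)
    have h0 : |p 0 - q 0| ≤ b - a := by
      rw [abs_le]; constructor <;> linarith [hp.1.1, hp.1.2, hq.1.1, hq.1.2]
    have h1 : |p 1 - q 1| ≤ d - c := by
      rw [abs_le]; constructor <;> linarith [hp.2.1, hp.2.2, hq.2.1, hq.2.2]
    linarith

/-- The conic function depends continuously, in the supremum norm, on the body. -/
theorem continuous_conicMap (a b c d : ℝ) : Continuous (conicMap a b c d) := by
  rw [continuous_iff_continuousAt]
  intro K
  have hlim := (((tendsto_setIntegral_indicator_sub K.1 (isCompact_box a b c d)).comp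
    (continuous_subtype_val.tendsto K)).const_mul ((b - a) + (d - c)))
  rw [mul_zero] at hlim
  rw [ContinuousAt, tendsto_iff_dist_tendsto_zero]
  refine squeeze_zero (fun _ => dist_nonneg) (fun L => ?_) hlim
  have hle := le_of_mem_levelSet K.2
  rw [ContinuousMap.dist_le]
  · intro p
    exact abs_conicFun_sub_le (subset_box_of_mem_levelSet K.2) (subset_box_of_mem_levelSet L.2) p.2
  · exact mul_nonneg (by linarith) (integral_nonneg fun _ => abs_nonneg _)

theorem isFiniteMeasure_boxMeasure (a b c d : ℝ) : IsFiniteMeasure (boxMeasure a b c d) := by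
  constructor
  rw [boxMeasure, comap_subtype_coe_apply (isCompact_box a b c d).measurableSet]
  simpa using (isCompact_box a b c d).measure_lt_top

theorem norm_continuousL1 {a b c d : ℝ} (f : ContinuousL1 a b c d) :
    ‖f‖ = ∫ p, |ContinuousMap.toFun f p| ∂(boxMeasure a b c d) := rfl

theorem continuous_conicMapL1 (a b c d : ℝ) : Continuous (conicMapL1 a b c d) := by
  have hfin := isFiniteMeasure_boxMeasure a b c d
  let T : C(box a b c d, ℝ) →+ ContinuousL1 a b c d := AddMonoidHom.id _
  have hT : Continuous T := by
    refine AddMonoidHomClass.continuous_of_bound T ((boxMeasure a b c d).real Set.univ) fun f => ?_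
    rw [norm_continuousL1]
    calc ∫ p, |f p| ∂(boxMeasure a b c d) ≤ ∫ p, ‖f‖ ∂(boxMeasure a b c d) :=
          integral_mono (integrable_boxMeasure f).abs (integrable_const _)
            fun p => f.norm_coe_le_norm p
      _ = _ := by rw [integral_const, smul_eq_mul]
  exact hT.comp (continuous_conicMap a b c d)

theorem closure_interior_box {a b c d : ℝ} (hab : a < b) (hcd : c < d) :
    closure (interior (box a b c d)) = box a b c d := by
  have hconv : Convex ℝ (box a b c d) := by
    intro p hp q hq r s hr hs hrs
    exact ⟨convex_Icc a b hp.1 hq.1 hr hs hrs, convex_Icc c d hp.2 hq.2 hr hs hrs⟩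
  have hne : (interior (box a b c d)).Nonempty := by
    refine ⟨!₂[(a + b) / 2, (c + d) / 2], ?_⟩
    have hsub : {p : Plane | p 0 ∈ Set.Ioo a b ∧ p 1 ∈ Set.Ioo c d} ⊆ box a b c d :=
      fun p hp => ⟨Set.Ioo_subset_Icc_self hp.1, Set.Ioo_subset_Icc_self hp.2⟩
    refine interior_maximal hsub ((isOpen_Ioo.preimage (continuous_coord 0)).inter
        (isOpen_Ioo.preimage (continuous_coord 1))) ?_
    refine ⟨?_, ?_⟩ <;> simp <;> constructor <;> linarith
  rw [hconv.closure_interior_eq_closure_of_nonempty_interior hne,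
    (isCompact_box a b c d).isClosed.closure_eq]

theorem isOpenPosMeasure_boxMeasure {a b c d : ℝ} (hab : a < b) (hcd : c < d) :
    (boxMeasure a b c d).IsOpenPosMeasure := by
  refine ⟨fun U hU hne h0 => ?_⟩
  obtain ⟨O, hO, rfl⟩ := isOpen_induced_iff.1 hU
  obtain ⟨p, hp⟩ := hne
  rw [boxMeasure, comap_subtype_coe_apply (isCompact_box a b c d).measurableSet] at h0
  have hpc : p.1 ∈ closure (interior (box a b c d)) := by
    rw [closure_interior_box hab hcd]; exact p.2
  obtain ⟨q, hqO, hqi⟩ := mem_closure_iff.1 hpc O hO hp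
  have hopen : IsOpen (O ∩ interior (box a b c d)) := hO.inter isOpen_interior
  refine (hopen.measure_pos volume ⟨q, hqO, hqi⟩).ne' (measure_mono_null ?_ h0)
  rintro z ⟨hzO, hzi⟩
  exact ⟨⟨z, interior_subset hzi⟩, hzO, rfl⟩

/-- Over a non-degenerate box the `L₁`-seminorm is a norm. -/
theorem t2Space_continuousL1 {a b c d : ℝ} (hab : a < b) (hcd : c < d) :
    T2Space (ContinuousL1 a b c d) := by
  have := isOpenPosMeasure_boxMeasure hab hcd
  have : T0Space (ContinuousL1 a b c d) := by
    refine ⟨fun f g h => ?_⟩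
    rw [Metric.inseparable_iff, dist_eq_norm, norm_continuousL1] at h
    have hi : Integrable (fun p => |ContinuousMap.toFun (f - g) p|) (boxMeasure a b c d) :=
      (integrable_boxMeasure (f - g : C(box a b c d, ℝ))).abs
    rw [integral_eq_zero_iff_of_nonneg (fun _ => abs_nonneg _) hi] at h
    have hc : Continuous fun p => |ContinuousMap.toFun (f - g) p| :=
      (ContinuousMap.continuous (f - g : C(box a b c d, ℝ))).abs
    have h0 := (hc.ae_eq_iff_eq (boxMeasure a b c d) continuous_zero).1 h
    refine ContinuousMap.ext (f := (f : C(box a b c d, ℝ))) fun p => ?_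
    have hp : |ContinuousMap.toFun (f - g) p| = 0 := congrFun h0 p
    exact sub_eq_zero.1 (abs_eq_zero.1 hp)
  infer_instance

/-! ### Compactness of the level sets -/

theorem isClosed_setOf_convex :
    IsClosed {s : TopologicalSpace.NonemptyCompacts Plane | Convex ℝ (s : Set Plane)} := by
  refine isClosed_of_closure_subset fun s hs => ?_
  intro x hx y hy r t hr ht hrt
  rw [← s.isCompact.isClosed.closure_eq, Metric.mem_closure_iff]
  intro ε hε
  obtain ⟨s', hs', hd⟩ := Metric.mem_closure_iff.1 hs (ε / 2) (by linarith)
  have hne : Metric.hausdorffEDist (s : Set Plane) s' ≠ ⊤ :=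
    Metric.hausdorffEDist_ne_top_of_nonempty_of_bounded s.nonempty s'.nonempty
      s.isCompact.isBounded s'.isCompact.isBounded
  rw [Metric.NonemptyCompacts.dist_eq] at hd
  obtain ⟨x', hx', hxx⟩ := Metric.exists_dist_lt_of_hausdorffDist_lt hx hd hne
  obtain ⟨y', hy', hyy⟩ := Metric.exists_dist_lt_of_hausdorffDist_lt hy hd hne
  obtain ⟨z, hz, hzz⟩ := Metric.exists_dist_lt_of_hausdorffDist_lt' (hs' hx' hy' hr ht hrt) hd hne
  refine ⟨z, hz, ?_⟩
  have h1 : dist (r • x + t • y) (r • x' + t • y') ≤ ε / 2 := by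
    refine (dist_add_add_le _ _ _ _).trans ?_
    rw [dist_smul₀, dist_smul₀, Real.norm_of_nonneg hr, Real.norm_of_nonneg ht]
    calc r * dist x x' + t * dist y y' ≤ r * (ε / 2) + t * (ε / 2) := by gcongr
      _ = ε / 2 := by rw [← add_mul, hrt, one_mul]
  calc dist (r • x + t • y) z ≤ dist (r • x + t • y) (r • x' + t • y') + dist (r • x' + t • y') z :=
        dist_triangle _ _ _
    _ < ε := by rw [dist_comm _ z]; linarith

/-- Blaschke's selection theorem for the bodies inscribed in a box. -/
theorem compactSpace_levelSet (a b c d : ℝ) : CompactSpace (levelSet a b c d) := by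
  let F : levelSet a b c d → TopologicalSpace.NonemptyCompacts Plane :=
    fun K => ⟨⟨K.1, K.1.isCompact⟩, K.1.nonempty⟩
  have hF : Isometry F := Isometry.of_dist_eq fun K L => rfl
  have hcl (i : Fin 2) (x : ℝ) : IsClosed {s : TopologicalSpace.NonemptyCompacts Plane |
      ((s : Set Plane) ∩ {q | q i = x}).Nonempty} :=
    TopologicalSpace.NonemptyCompacts.isClosed_inter_nonempty_of_isClosed
      (isClosed_eq (continuous_coord i) continuous_const)
  rcases isEmpty_or_nonempty (levelSet a b c d) with hemp | ⟨⟨K₀⟩⟩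
  · infer_instance
  have hle := le_of_mem_levelSet K₀.2
  have hrange : F '' Set.univ =
      {s : TopologicalSpace.NonemptyCompacts Plane | (s : Set Plane) ⊆ box a b c d} ∩
      ({s : TopologicalSpace.NonemptyCompacts Plane | Convex ℝ (s : Set Plane)} ∩ ((⋂ x ∈ Set.Icc a b,
        {s : TopologicalSpace.NonemptyCompacts Plane |
          ((s : Set Plane) ∩ {q | q 0 = x}).Nonempty}) ∩ ⋂ y ∈ Set.Icc c d,
        {s : TopologicalSpace.NonemptyCompacts Plane |
          ((s : Set Plane) ∩ {q | q 1 = y}).Nonempty})) := by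
    ext s
    simp only [Set.mem_image, Set.mem_univ, true_and, Set.mem_inter_iff, Set.mem_iInter]
    constructor
    · rintro ⟨K, rfl⟩
      refine ⟨subset_box_of_mem_levelSet K.2, K.1.convex, fun x hx => ?_, fun y hy => ?_⟩
      · rw [← shadow_of_mem_levelSet K.2] at hx
        exact hx
      · rw [← shadow_swapBody_of_mem_levelSet K.2, shadow_swapBody] at hy
        exact hy
    · rintro ⟨hsub, hconv, hx, hy⟩
      refine ⟨⟨⟨s, hconv, s.isCompact, s.nonempty⟩, ?_⟩, rfl⟩
      change prodProj (s : Set Plane) = box a b c d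
      ext p
      constructor
      · rintro ⟨⟨q, hq, hq0⟩, ⟨q', hq', hq1⟩⟩
        exact ⟨hq0 ▸ (hsub hq).1, hq1 ▸ (hsub hq').2⟩
      · rintro ⟨hp0, hp1⟩
        exact ⟨hx _ hp0, hy _ hp1⟩
  have hcpt : IsCompact (F '' Set.univ) := by
    rw [hrange]
    refine (TopologicalSpace.NonemptyCompacts.isCompact_subsets_of_isCompact
      (isCompact_box a b c d)).inter_right (isClosed_setOf_convex.inter (IsClosed.inter ?_ ?_))
    · exact isClosed_biInter fun x _ => hcl 0 x
    · exact isClosed_biInter fun x _ => hcl 1 x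
  exact ⟨(hF.isEmbedding.isInducing.isCompact_iff).2 hcpt⟩

/-- If the fibre of a continuous map on a compact space through `K` is a singleton, the inverse is
lower semi-continuous there: a body far from `K` has a value far from that of `K`. -/
theorem inverseLowerSemicontinuousAt_of_fiber_eq {M W : Type*} [TopologicalSpace M]
    [CompactSpace M] [TopologicalSpace W] [T2Space W] {Φ : M → W} (hΦ : Continuous Φ) {K : M}
    (hK : ∀ L, Φ L = Φ K → L = K) : InverseLowerSemicontinuousAt Φ K := by
  rw [InverseLowerSemicontinuousAt, lowerHemicontinuousAt_iff]
  rintro V hV ⟨L, hL, hLV⟩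
  obtain rfl := hK L hL
  have hC : IsClosed (Φ '' Vᶜ) := (hV.isClosed_compl.isCompact.image hΦ).isClosed
  have hn : (Subtype.val : Set.range Φ → W) ⁻¹' (Φ '' Vᶜ)ᶜ ∈ nhds (Set.rangeFactorization Φ L) := by
    refine (hC.isOpen_compl.preimage continuous_subtype_val).mem_nhds ?_
    rintro ⟨L', hL', h⟩
    exact hL' (hK L' h ▸ hLV)
  filter_upwards [hn] with w hw
  obtain ⟨L', hL'⟩ := w.2
  refine ⟨L', hL', ?_⟩
  by_contra h
  exact hw ⟨L', h, hL'⟩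

/-! ### Extreme points of bodies with the X-rays of a polygon -/

/-- The abscissa of an extreme point cannot lie in an open interval on which the length of the
vertical slices is affine: there the upper and the lower boundary are both affine. -/
theorem notMem_extremePoints_of_affine {K : ConvexBody Plane} {a b u v m k : ℝ} {e : Plane}
    (hK : shadow K = Set.Icc a b) (huv : Set.Icc u v ⊆ Set.Icc a b)
    (haff : ∀ z ∈ Set.Icc u v, upperFun K z - lowerFun K z = m * z + k)
    (hu : u < e 0) (hv : e 0 < v) : e ∉ (K : Set Plane).extremePoints ℝ := by
  intro he
  have heK : e ∈ K := he.1
  set x := e 0 with hx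
  obtain ⟨h, hh, hhu, hhv⟩ : ∃ h > 0, u ≤ x - h ∧ x + h ≤ v :=
    ⟨min (x - u) (v - x), lt_min (by linarith) (by linarith),
      by linarith [min_le_left (x - u) (v - x)], by linarith [min_le_right (x - u) (v - x)]⟩
  have hm0 : x ∈ Set.Icc u v := ⟨by linarith, by linarith⟩
  have hm1 : x - h ∈ Set.Icc u v := ⟨by linarith, by linarith⟩
  have hm2 : x + h ∈ Set.Icc u v := ⟨by linarith, by linarith⟩
  have c1 := (ConvexBody.concaveOn_upperFun hK).2 (huv hm1) (huv hm2)
    (by norm_num : (0 : ℝ) ≤ 1 / 2) (by norm_num : (0 : ℝ) ≤ 1 / 2) (by norm_num)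
  have c2 := (ConvexBody.convexOn_lowerFun hK).2 (huv hm1) (huv hm2)
    (by norm_num : (0 : ℝ) ≤ 1 / 2) (by norm_num : (0 : ℝ) ≤ 1 / 2) (by norm_num)
  have hmid : (1 / 2 : ℝ) • (x - h) + (1 / 2 : ℝ) • (x + h) = x := by
    simp only [smul_eq_mul]; ring
  rw [hmid] at c1 c2
  simp only [smul_eq_mul] at c1 c2
  have a0 := haff _ hm0
  have a1 := haff _ hm1
  have a2 := haff _ hm2
  have hup : upperFun K x = 1 / 2 * upperFun K (x - h) + 1 / 2 * upperFun K (x + h) := by linarith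
  have hlo : lowerFun K x = 1 / 2 * lowerFun K (x - h) + 1 / 2 * lowerFun K (x + h) := by linarith
  have hseg : e 1 ∈ segment ℝ (lowerFun K x) (upperFun K x) := by
    obtain ⟨-, h1, h2⟩ := (ConvexBody.mem_iff hK).1 heK
    rw [segment_eq_Icc (h1.trans h2)]
    exact ⟨h1, h2⟩
  obtain ⟨r, s, hr, hs, hrs, hrse⟩ := hseg
  simp only [smul_eq_mul] at hrse
  have hin : ∀ z ∈ Set.Icc u v, !₂[z, r * lowerFun K z + s * upperFun K z] ∈ K := fun z hz => by
    have := K.convex (K.lowerFun_mem hK (huv hz)) (K.upperFun_mem hK (huv hz)) hr hs hrs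
    rwa [combo_mk, ← add_mul, hrs, one_mul] at this
  have hopen : e ∈ openSegment ℝ
      (!₂[x - h, r * lowerFun K (x - h) + s * upperFun K (x - h)] : Plane)
      !₂[x + h, r * lowerFun K (x + h) + s * upperFun K (x + h)] := by
    refine ⟨1 / 2, 1 / 2, by norm_num, by norm_num, by norm_num, ?_⟩
    have h0 : 1 / 2 * (x - h) + 1 / 2 * (x + h) = x := by ring
    have h1 : 1 / 2 * (r * lowerFun K (x - h) + s * upperFun K (x - h)) +
        1 / 2 * (r * lowerFun K (x + h) + s * upperFun K (x + h)) = e 1 := by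
      rw [← hrse, hup, hlo]; ring
    rw [combo_mk, h0, h1, hx, plane_eta]
  have := he.2 (hin _ hm1) (hin _ hm2) hopen
  have h0 := congrArg (fun p : Plane => p 0) this
  simp only [Matrix.cons_val_zero, ← hx] at h0
  linarith

theorem convex_setOf_coord (i : Fin 2) {s : Set ℝ} (hs : Convex ℝ s) :
    Convex ℝ {p : Plane | p i ∈ s} := by
  intro p hp q hq r t hr ht hrt
  exact hs hp hq hr ht hrt

/-- Over an interval free of abscissas of vertices, a point of a polygon lies below the chord
spanned by the upper boundary over the endpoints, and above that of the lower boundary. -/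
theorem mem_polygon_between {L : ConvexBody Plane} {V : Set Plane} {a b u v z y : ℝ}
    (hL : shadow L = Set.Icc a b) (hV : (L : Set Plane) = convexHull ℝ V)
    (hu : a ≤ u) (hv : v ≤ b) (huv : u < v)
    (hgap : ∀ p ∈ V, p 0 ≤ u ∨ v ≤ p 0) (hz : z ∈ Set.Icc u v) (hy : !₂[z, y] ∈ L) :
    (v - z) * lowerFun L u + (z - u) * lowerFun L v ≤ (v - u) * y ∧
      (v - u) * y ≤ (v - z) * upperFun L u + (z - u) * upperFun L v := by
  have hum : u ∈ Set.Icc a b := ⟨hu, huv.le.trans hv⟩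
  have hvm : v ∈ Set.Icc a b := ⟨hu.trans huv.le, hv⟩
  -- the vertices on the left and on the right of the gap
  have hVsplit : V = {p ∈ V | p 0 ≤ u} ∪ {p ∈ V | v ≤ p 0} := by
    ext p
    constructor
    · intro hp
      exact (hgap p hp).imp (fun h => ⟨hp, h⟩) fun h => ⟨hp, h⟩
    · rintro (h | h) <;> exact h.1
  have hl : convexHull ℝ {p ∈ V | p 0 ≤ u} ⊆ {p : Plane | p 0 ≤ u} :=
    convexHull_min (fun p hp => hp.2) (convex_setOf_coord 0 (convex_Iic u))
  have hr : convexHull ℝ {p ∈ V | v ≤ p 0} ⊆ {p : Plane | v ≤ p 0} :=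
    convexHull_min (fun p hp => hp.2) (convex_setOf_coord 0 (convex_Ici v))
  have hne1 : {p ∈ V | p 0 ≤ u}.Nonempty := by
    by_contra hne
    rw [Set.not_nonempty_iff_eq_empty] at hne
    rw [hne, Set.empty_union] at hVsplit
    have : v ≤ u := by
      have h1 := L.upperFun_mem hL hum
      rw [← SetLike.mem_coe, hV, hVsplit] at h1
      simpa using hr h1
    linarith
  have hne2 : {p ∈ V | v ≤ p 0}.Nonempty := by
    by_contra hne
    rw [Set.not_nonempty_iff_eq_empty] at hne
    rw [hne, Set.union_empty] at hVsplit
    have : v ≤ u := by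
      have h1 := L.upperFun_mem hL hvm
      rw [← SetLike.mem_coe, hV, hVsplit] at h1
      simpa using hl h1
    linarith
  have hy' := hy
  rw [← SetLike.mem_coe, hV, hVsplit, convexHull_union hne1 hne2, mem_convexJoin] at hy'
  obtain ⟨A, hA, B, hB, r, s, hr0, hs0, hrs, hAB⟩ := hy'
  have hA0 : A 0 ≤ u := hl hA
  have hB0 : v ≤ B 0 := hr hB
  have hAL : A ∈ L := by
    rw [← SetLike.mem_coe, hV]; exact convexHull_mono (fun p hp => hp.1) hA
  have hBL : B ∈ L := by
    rw [← SetLike.mem_coe, hV]; exact convexHull_mono (fun p hp => hp.1) hB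
  rw [combo_eq] at hAB
  have e0 := congrArg (fun p : Plane => p 0) hAB
  have e1 := congrArg (fun p : Plane => p 1) hAB
  simp only [Matrix.cons_val_zero, Matrix.cons_val_one] at e0 e1
  have hD : 0 < B 0 - A 0 := by linarith
  -- the points where the segment `AB` crosses the two ends of the gap
  have hcross : ∀ w ∈ Set.Icc u v,
      !₂[w, ((B 0 - w) * A 1 + (w - A 0) * B 1) / (B 0 - A 0)] ∈ L := fun w hw => by
    have := L.convex hAL hBL (a := (B 0 - w) / (B 0 - A 0)) (b := (w - A 0) / (B 0 - A 0))
      (div_nonneg (by linarith [hw.2]) hD.le) (div_nonneg (by linarith [hw.1]) hD.le)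
      (by field_simp; ring)
    have h0 : (B 0 - w) / (B 0 - A 0) * A 0 + (w - A 0) / (B 0 - A 0) * B 0 = w := by
      field_simp; ring
    have h1 : (B 0 - w) / (B 0 - A 0) * A 1 + (w - A 0) / (B 0 - A 0) * B 1 =
        ((B 0 - w) * A 1 + (w - A 0) * B 1) / (B 0 - A 0) := by
      field_simp
    rwa [combo_eq, h0, h1] at this
  have hU := (ConvexBody.mem_mk_iff hL hum).1 (hcross u ⟨le_rfl, huv.le⟩)
  have hW := (ConvexBody.mem_mk_iff hL hvm).1 (hcross v ⟨huv.le, le_rfl⟩)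
  have hyD : (v - u) * y = (v - z) * (((B 0 - u) * A 1 + (u - A 0) * B 1) / (B 0 - A 0)) +
      (z - u) * (((B 0 - v) * A 1 + (v - A 0) * B 1) / (B 0 - A 0)) := by
    obtain rfl : s = 1 - r := by linarith
    rw [← e0, ← e1]
    field_simp
    ring
  rw [hyD]
  have hz1 : 0 ≤ v - z := by linarith [hz.2]
  have hz2 : 0 ≤ z - u := by linarith [hz.1]
  exact ⟨add_le_add (mul_le_mul_of_nonneg_left hU.1 hz1) (mul_le_mul_of_nonneg_left hW.1 hz2),
    add_le_add (mul_le_mul_of_nonneg_left hU.2 hz1) (mul_le_mul_of_nonneg_left hW.2 hz2)⟩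

/-- The slice lengths of a polygon are affine between consecutive abscissas of vertices. -/
theorem polygon_width_affine {L : ConvexBody Plane} {V : Set Plane} {a b u v : ℝ}
    (hL : shadow L = Set.Icc a b) (hV : (L : Set Plane) = convexHull ℝ V)
    (hu : a ≤ u) (hv : v ≤ b) (huv : u < v) (hgap : ∀ p ∈ V, p 0 ≤ u ∨ v ≤ p 0) :
    ∃ m k : ℝ, ∀ z ∈ Set.Icc u v, upperFun L z - lowerFun L z = m * z + k := by
  have hum : u ∈ Set.Icc a b := ⟨hu, huv.le.trans hv⟩
  have hvm : v ∈ Set.Icc a b := ⟨hu.trans huv.le, hv⟩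
  have hD : 0 < v - u := by linarith
  set wu := upperFun L u - lowerFun L u
  set wv := upperFun L v - lowerFun L v
  refine ⟨(wv - wu) / (v - u), (v * wu - u * wv) / (v - u), fun z hz => ?_⟩
  have hzm : z ∈ Set.Icc a b := ⟨hu.trans hz.1, hz.2.trans hv⟩
  have hup := (mem_polygon_between hL hV hu hv huv hgap hz (L.upperFun_mem hL hzm)).2
  have hlo := (mem_polygon_between hL hV hu hv huv hgap hz (L.lowerFun_mem hL hzm)).1
  have hr : 0 ≤ (v - z) / (v - u) := div_nonneg (by linarith [hz.2]) hD.le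
  have hs : 0 ≤ (z - u) / (v - u) := div_nonneg (by linarith [hz.1]) hD.le
  have hrs : (v - z) / (v - u) + (z - u) / (v - u) = 1 := by field_simp; ring
  have hcomb : (v - z) / (v - u) * u + (z - u) / (v - u) * v = z := by field_simp; ring
  have c1 := (ConvexBody.concaveOn_upperFun hL).2 hum hvm hr hs hrs
  have c2 := (ConvexBody.convexOn_lowerFun hL).2 hum hvm hr hs hrs
  simp only [smul_eq_mul, hcomb] at c1 c2
  rw [div_mul_eq_mul_div, div_mul_eq_mul_div, ← add_div, div_le_iff₀ hD] at c1
  rw [div_mul_eq_mul_div, div_mul_eq_mul_div, ← add_div, le_div_iff₀ hD] at c2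
  have key : (v - u) * (upperFun L z - lowerFun L z) = (v - z) * wu + (z - u) * wv := by
    simp only [wu, wv]; linarith
  field_simp
  linarith

/-- A convex body with the same vertical X-ray as a polygon has its extreme points only on
verticals through vertices of the polygon or on the two extreme verticals. -/
theorem extremePoint_fst_mem {K L : ConvexBody Plane} {V : Set Plane} {a b : ℝ} {e : Plane}
    (hK : shadow K = Set.Icc a b) (hL : shadow L = Set.Icc a b)
    (hV : (L : Set Plane) = convexHull ℝ V) (hfin : V.Finite)
    (hX : ∀ x, x ≠ a → x ≠ b → xrayY K x = xrayY L x)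
    (he : e ∈ (K : Set Plane).extremePoints ℝ) :
    e 0 ∈ insert a (insert b ((fun p : Plane => p 0) '' V)) := by
  by_contra hcon
  have hfin' : (insert a (insert b ((fun p : Plane => p 0) '' V))).Finite :=
    ((hfin.image _).insert b).insert a
  have hopen : (insert a (insert b ((fun p : Plane => p 0) '' V)))ᶜ ∈ nhds (e 0) :=
    hfin'.isClosed.isOpen_compl.mem_nhds hcon
  obtain ⟨ε, hε, hball⟩ := Metric.nhds_basis_closedBall.mem_iff.1 hopen
  rw [Real.closedBall_eq_Icc] at hball
  have heab := ConvexBody.mem_shadow hK he.1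
  have hau : a ≤ e 0 - ε := by
    by_contra! h
    exact hball ⟨h.le, by linarith [heab.1]⟩ (Set.mem_insert _ _)
  have hbv : e 0 + ε ≤ b := by
    by_contra! h
    exact hball ⟨by linarith [heab.2], h.le⟩ (Set.mem_insert_of_mem _ (Set.mem_insert _ _))
  have hgap : ∀ p ∈ V, p 0 ≤ e 0 - ε ∨ e 0 + ε ≤ p 0 := by
    intro p hp
    by_contra! h
    exact hball ⟨h.1.le, h.2.le⟩
      (Set.mem_insert_of_mem _ (Set.mem_insert_of_mem _ ⟨p, hp, rfl⟩))
  obtain ⟨m, k, hmk⟩ := polygon_width_affine hL hV hau hbv (by linarith) hgap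
  refine notMem_extremePoints_of_affine (m := m) (k := k) hK
    (fun z hz => ⟨hau.trans hz.1, hz.2.trans hbv⟩)
    (fun z hz => ?_) (by linarith) (by linarith) he
  have hzab : z ∈ Set.Icc a b := ⟨hau.trans hz.1, hz.2.trans hbv⟩
  rw [← hmk z hz, ← ConvexBody.toReal_xrayY hK hzab, ← ConvexBody.toReal_xrayY hL hzab,
    hX z (fun h => hball hz (h ▸ Set.mem_insert _ _))
      (fun h => hball hz (h ▸ Set.mem_insert_of_mem _ (Set.mem_insert _ _)))]

theorem swapBody_eq_convexHull {L : ConvexBody Plane} {V : Set Plane}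
    (hV : (L : Set Plane) = convexHull ℝ V) :
    (swapBody L : Set Plane) = convexHull ℝ (swapEquiv '' V) := by
  have h := swapEquiv.toLinearEquiv.toLinearMap.image_convexHull V
  have h' : swapEquiv '' convexHull ℝ V = convexHull ℝ (swapEquiv '' V) := h
  rw [← h', coe_swapBody, hV]
  ext p
  constructor
  · intro hp
    exact ⟨swapEquiv p, hp, swapEquiv_swapEquiv p⟩
  · rintro ⟨q, hq, rfl⟩
    change swapEquiv (swapEquiv q) ∈ convexHull ℝ V
    rwa [swapEquiv_swapEquiv]

theorem swapEquiv_mem_extremePoints {K : ConvexBody Plane} {e : Plane}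
    (he : e ∈ (K : Set Plane).extremePoints ℝ) :
    swapEquiv e ∈ (swapBody K : Set Plane).extremePoints ℝ := by
  have h : (swapBody K : Set Plane) = swapEquiv '' (K : Set Plane) := by
    ext p
    constructor
    · intro hp
      exact ⟨_, hp, swapEquiv_swapEquiv p⟩
    · rintro ⟨q, hq, rfl⟩
      change swapEquiv (swapEquiv q) ∈ (K : Set Plane)
      rwa [swapEquiv_swapEquiv]
  rw [h, ← image_extremePoints]
  exact ⟨e, he, rfl⟩

/-- The horizontal counterpart of `extremePoint_fst_mem`. -/
theorem extremePoint_snd_mem {K L : ConvexBody Plane} {V : Set Plane} {c d : ℝ} {e : Plane}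
    (hK : shadow (swapBody K) = Set.Icc c d) (hL : shadow (swapBody L) = Set.Icc c d)
    (hV : (L : Set Plane) = convexHull ℝ V) (hfin : V.Finite)
    (hX : ∀ y, y ≠ c → y ≠ d → xrayX K y = xrayX L y)
    (he : e ∈ (K : Set Plane).extremePoints ℝ) :
    e 1 ∈ insert c (insert d ((fun p : Plane => p 1) '' V)) := by
  have := extremePoint_fst_mem hK hL (swapBody_eq_convexHull hV) (hfin.image _)
    (fun y hc hd => by rw [xrayY_swapBody, xrayY_swapBody, hX y hc hd])
    (swapEquiv_mem_extremePoints he)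
  rw [Set.image_image] at this
  simpa [swapEquiv_apply] using this

/-- A point of a convex body on a non-vertical support line is the interpolation of two extreme
points. If both of them lie on the vertical through the point, the weight is `0 / 0 = 0` and the
point equals the second of them. -/
theorem exists_extremePoints_of_support {K : ConvexBody Plane} {q : Plane} {r s : ℝ} (hs : s ≠ 0)
    (hq : q ∈ K) (hmax : ∀ p ∈ K, r * p 0 + s * p 1 ≤ r * q 0 + s * q 1) :
    ∃ e₁ ∈ (K : Set Plane).extremePoints ℝ, ∃ e₂ ∈ (K : Set Plane).extremePoints ℝ,
      ∃ w ∈ Set.Icc (0 : ℝ) 1, w = (q 0 - e₂ 0) / (e₁ 0 - e₂ 0) ∧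
        q 1 = w * e₁ 1 + (1 - w) * e₂ 1 := by
  let l : StrongDual ℝ Plane :=
    r • (EuclideanSpace.proj 0 : Plane →L[ℝ] ℝ) + s • (EuclideanSpace.proj 1 : Plane →L[ℝ] ℝ)
  have hl (p : Plane) : l p = r * p 0 + s * p 1 := by simp [l]
  set F := l.toExposed (K : Set Plane) with hF
  have hFe : IsExposed ℝ (K : Set Plane) F := ContinuousLinearMap.toExposed.isExposed
  have hFc : IsCompact F := hFe.isCompact K.isCompact
  have hqF : q ∈ F := ⟨hq, fun p hp => by rw [hl, hl]; exact hmax p hp⟩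
  -- an extreme point of the support set at which a further functional is maximal
  have hext (g : StrongDual ℝ Plane) : ∃ e ∈ (K : Set Plane).extremePoints ℝ, e ∈ F ∧ g q ≤ g e := by
    have hGe : IsExposed ℝ F (g.toExposed F) := ContinuousLinearMap.toExposed.isExposed
    have hGne : (g.toExposed F).Nonempty := by
      obtain ⟨x, hx, hxm⟩ := hFc.exists_isMaxOn ⟨q, hqF⟩ g.continuous.continuousOn
      exact ⟨x, hx, fun y hy => hxm hy⟩
    obtain ⟨e, he⟩ := (hGe.isCompact hFc).extremePoints_nonempty hGne
    have heF := hGe.isExtreme.extremePoints_subset_extremePoints he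
    exact ⟨e, hFe.isExtreme.extremePoints_subset_extremePoints heF, heF.1, he.1.2 q hqF⟩
  obtain ⟨e₁, he₁, hF₁, hm₁⟩ := hext (-(EuclideanSpace.proj 0 : Plane →L[ℝ] ℝ))
  obtain ⟨e₂, he₂, hF₂, hm₂⟩ := hext (EuclideanSpace.proj 0 : Plane →L[ℝ] ℝ)
  have h1 : e₁ 0 ≤ q 0 := by simpa using hm₁
  have h2 : q 0 ≤ e₂ 0 := by simpa using hm₂
  have hline {e : Plane} (he : e ∈ F) : r * e 0 + s * e 1 = r * q 0 + s * q 1 := by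
    rw [← hl, ← hl]
    exact le_antisymm (hqF.2 e he.1) (he.2 q hq)
  have l1 := hline hF₁
  have l2 := hline hF₂
  refine ⟨e₁, he₁, e₂, he₂, _, ?_, rfl, ?_⟩
  · constructor
    · exact div_nonneg_of_nonpos (by linarith) (by linarith)
    · exact div_le_one_of_ge (by linarith) (by linarith)
  · rcases (h1.trans h2).eq_or_lt with h | h
    · have hq2 : q 0 = e₂ 0 := by linarith
      rw [hq2, h, sub_self, div_zero, zero_mul, sub_zero, one_mul, zero_add]
      rw [hq2] at l2
      exact (mul_left_cancel₀ hs (by linarith)).symm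
    · have hD : e₁ 0 - e₂ 0 ≠ 0 := by linarith
      apply mul_left_cancel₀ hs
      have e1 : s * e₁ 1 = r * q 0 + s * q 1 - r * e₁ 0 := by linarith
      have e2 : s * e₂ 1 = r * q 0 + s * q 1 - r * e₂ 0 := by linarith
      rw [mul_add, mul_left_comm, mul_left_comm s (1 - _), e1, e2]
      field_simp
      ring

theorem ConvexOn.exists_affine_support {g : ℝ → ℝ} {a b x : ℝ}
    (hg : ConvexOn ℝ (Set.Icc a b) g) (hx : x ∈ Set.Ioo a b) :
    ∃ m : ℝ, ∀ z ∈ Set.Icc a b, g x + m * (z - x) ≤ g z := by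
  have hxi : x ∈ interior (Set.Icc a b) := by rwa [interior_Icc]
  refine ⟨derivWithin g (Set.Ioi x) x, fun z hz => ?_⟩
  rcases lt_trichotomy z x with h | rfl | h
  · have h1 := hg.slope_le_leftDeriv_of_mem_interior hz hxi h
    have h2 := hg.leftDeriv_le_rightDeriv_of_mem_interior hxi
    have h3 := h1.trans h2
    rw [slope_def_field, div_le_iff₀ (by linarith)] at h3
    linarith
  · simp
  · have h1 := hg.rightDeriv_le_slope_of_mem_interior hxi hz h
    rw [slope_def_field, le_div_iff₀ (by linarith)] at h1
    linarith

theorem upperFun_eq_interpolation {K : ConvexBody Plane} {a b x : ℝ}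
    (hK : shadow K = Set.Icc a b) (hx : x ∈ Set.Ioo a b) :
    ∃ e₁ ∈ (K : Set Plane).extremePoints ℝ, ∃ e₂ ∈ (K : Set Plane).extremePoints ℝ,
      ∃ w ∈ Set.Icc (0 : ℝ) 1, w = (x - e₂ 0) / (e₁ 0 - e₂ 0) ∧
        upperFun K x = w * e₁ 1 + (1 - w) * e₂ 1 := by
  obtain ⟨m, hm⟩ := (ConvexBody.concaveOn_upperFun hK).neg.exists_affine_support hx
  have := exists_extremePoints_of_support (K := K) (q := !₂[x, upperFun K x]) (r := m) (s := 1)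
    one_ne_zero (K.upperFun_mem hK (Set.Ioo_subset_Icc_self hx)) (fun p hp => ?_)
  · simpa using this
  · obtain ⟨hp0, -, hp1⟩ := (ConvexBody.mem_iff hK).1 hp
    have := hm _ hp0
    simp only [Pi.neg_apply, Matrix.cons_val_zero, Matrix.cons_val_one] at this ⊢
    linarith

theorem lowerFun_eq_interpolation {K : ConvexBody Plane} {a b x : ℝ}
    (hK : shadow K = Set.Icc a b) (hx : x ∈ Set.Ioo a b) :
    ∃ e₁ ∈ (K : Set Plane).extremePoints ℝ, ∃ e₂ ∈ (K : Set Plane).extremePoints ℝ,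
      ∃ w ∈ Set.Icc (0 : ℝ) 1, w = (x - e₂ 0) / (e₁ 0 - e₂ 0) ∧
        lowerFun K x = w * e₁ 1 + (1 - w) * e₂ 1 := by
  obtain ⟨m, hm⟩ := (ConvexBody.convexOn_lowerFun hK).exists_affine_support hx
  have := exists_extremePoints_of_support (K := K) (q := !₂[x, lowerFun K x]) (r := m) (s := -1)
    (by norm_num) (K.lowerFun_mem hK (Set.Ioo_subset_Icc_self hx)) (fun p hp => ?_)
  · simpa using this
  · obtain ⟨hp0, hp1, -⟩ := (ConvexBody.mem_iff hK).1 hp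
    have := hm _ hp0
    simp only [Matrix.cons_val_zero, Matrix.cons_val_one] at this ⊢
    linarith

/-- The affine functions `t ↦ w.1 + w.2 * t` that arise by interpolating at `x`, between nodes
in `X`, two of the affine functions with coefficients in `P`. -/
def interpolants (X : Set ℝ) (P : Set (ℝ × ℝ)) (x : ℝ) : Set (ℝ × ℝ) :=
  {w | ∃ x₁ ∈ X, ∃ x₂ ∈ X, ∃ p₁ ∈ P, ∃ p₂ ∈ P, (x - x₂) / (x₁ - x₂) ∈ Set.Icc (0 : ℝ) 1 ∧
    w = ((x - x₂) / (x₁ - x₂)) • p₁ + (1 - (x - x₂) / (x₁ - x₂)) • p₂}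

theorem finite_interpolants {X : Set ℝ} {P : Set (ℝ × ℝ)} (hX : X.Finite) (hP : P.Finite) (x : ℝ) :
    (interpolants X P x).Finite := by
  refine (((hX.prod hX).prod (hP.prod hP)).image fun z : (ℝ × ℝ) × ((ℝ × ℝ) × (ℝ × ℝ)) =>
    ((x - z.1.2) / (z.1.1 - z.1.2)) • z.2.1 + (1 - (x - z.1.2) / (z.1.1 - z.1.2)) • z.2.2).subset ?_
  rintro w ⟨x₁, h₁, x₂, h₂, p₁, hp₁, p₂, hp₂, -, rfl⟩
  exact ⟨((x₁, x₂), (p₁, p₂)), ⟨⟨h₁, h₂⟩, ⟨hp₁, hp₂⟩⟩, rfl⟩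

/-- An interpolant has slope in `[0, 1]`, and slope `1` only if all nodes that matter move. -/
theorem interpolants_slope {X : Set ℝ} {P : Set (ℝ × ℝ)} {x y₀ : ℝ} {w : ℝ × ℝ}
    (hP : ∀ p ∈ P, p.2 = 0 ∨ p = (y₀, 1)) (hw : w ∈ interpolants X P x) :
    0 ≤ w.2 ∧ w.2 ≤ 1 ∧ (w.2 = 1 → w.1 = y₀) := by
  obtain ⟨x₁, -, x₂, -, p₁, h₁, p₂, h₂, ⟨hr0, hr1⟩, rfl⟩ := hw
  set r := (x - x₂) / (x₁ - x₂)
  simp only [Prod.fst_add, Prod.snd_add, Prod.smul_fst, Prod.smul_snd, smul_eq_mul]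
  rcases hP p₁ h₁ with h₁ | rfl <;> rcases hP p₂ h₂ with h₂ | rfl
  · rw [h₁, h₂]; simp
  · rw [h₁]
    refine ⟨by linarith, by linarith, fun h => ?_⟩
    have : r = 0 := by linarith
    rw [this]; simp
  · rw [h₂]
    refine ⟨by linarith, by linarith, fun h => ?_⟩
    have : r = 1 := by linarith
    rw [this]; simp
  · exact ⟨by simp, by simp, fun _ => by ring⟩

/-- Let one vertex of a polygon move vertically along `t ↦ (x, y₀ + t)`, so that the slice over `x`
has length `l + t`. If for infinitely many `t` a body `K t` has the same conic function in the box
as the polygon `L t`, then some `K t` contains the moving vertex. -/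
theorem exists_moving_vertex_mem {a b c d x y₀ l : ℝ} {V : Set Plane} {S : Set ℝ}
    {K L : ℝ → ConvexBody Plane} (hx : x ∈ Set.Ioo a b) (hcd : c < d) (hfin : V.Finite)
    (hS : S.Infinite) (hK : ∀ t ∈ S, K t ∈ levelSet a b c d)
    (hL : ∀ t ∈ S, L t ∈ levelSet a b c d)
    (hV : ∀ t ∈ S, (L t : Set Plane) = convexHull ℝ (insert !₂[x, y₀ + t] V))
    (hwidth : ∀ t ∈ S, upperFun (L t) x - lowerFun (L t) x = l + t)
    (hconic : ∀ t ∈ S, ∀ p, p 0 ∈ Set.Ioo a b → p 1 ∈ Set.Ioo c d →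
      conicFun (K t) p = conicFun (L t) p) :
    ∃ t ∈ S, !₂[x, y₀ + t] ∈ K t := by
  have hab : a < b := hx.1.trans hx.2
  let X : Set ℝ := insert a (insert b (insert x ((fun p : Plane => p 0) '' V)))
  let P : Set (ℝ × ℝ) := insert (y₀, 1) ((fun y => (y, 0)) ''
    (insert c (insert d ((fun p : Plane => p 1) '' V))))
  have hXfin : X.Finite := (((hfin.image _).insert x).insert b).insert a
  have hPfin : P.Finite := ((((hfin.image _).insert d).insert c).image _).insert _
  have hP : ∀ p ∈ P, p.2 = 0 ∨ p = (y₀, 1) := by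
    rintro p (rfl | ⟨y, -, rfl⟩)
    · exact Or.inr rfl
    · exact Or.inl rfl
  have hY {t : ℝ} (ht : t ∈ S) (z : ℝ) (hza : z ≠ a) (hzb : z ≠ b) :
      xrayY (K t) z = xrayY (L t) z :=
    xrayY_eq_of_eqOn_box (shadow_of_mem_levelSet (hK t ht)) (shadow_of_mem_levelSet (hL t ht)) hcd
      (hconic t ht) hza hzb
  have hX {t : ℝ} (ht : t ∈ S) (z : ℝ) (hzc : z ≠ c) (hzd : z ≠ d) :
      xrayX (K t) z = xrayX (L t) z := by
    rw [← xrayY_swapBody, ← xrayY_swapBody]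
    refine xrayY_eq_of_eqOn_box (shadow_swapBody_of_mem_levelSet (hK t ht))
      (shadow_swapBody_of_mem_levelSet (hL t ht)) hab (fun p hp0 hp1 => ?_) hzc hzd
    rw [conicFun_swapBody, conicFun_swapBody]
    exact hconic t ht _ (by simpa using hp1) (by simpa using hp0)
  have hXmem {t : ℝ} (ht : t ∈ S) {e : Plane} (he : e ∈ (K t : Set Plane).extremePoints ℝ) :
      e 0 ∈ X := by
    have := extremePoint_fst_mem (shadow_of_mem_levelSet (hK t ht))
      (shadow_of_mem_levelSet (hL t ht)) (hV t ht) (hfin.insert _) (hY ht) he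
    rw [Set.image_insert_eq] at this
    exact this
  have hPmem {t : ℝ} (ht : t ∈ S) {e : Plane} (he : e ∈ (K t : Set Plane).extremePoints ℝ) :
      ∃ p ∈ P, e 1 = p.1 + p.2 * t := by
    have := extremePoint_snd_mem (shadow_swapBody_of_mem_levelSet (hK t ht))
      (shadow_swapBody_of_mem_levelSet (hL t ht)) (hV t ht) (hfin.insert _) (hX ht) he
    rw [Set.image_insert_eq] at this
    rcases this with h | h | h | h
    · exact ⟨(c, 0), Or.inr ⟨c, Or.inl rfl, rfl⟩, by simpa using h⟩
    · exact ⟨(d, 0), Or.inr ⟨d, Or.inr (Or.inl rfl), rfl⟩, by simpa using h⟩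
    · exact ⟨(y₀, 1), Or.inl rfl, by simpa using h⟩
    · exact ⟨(e 1, 0), Or.inr ⟨e 1, Or.inr (Or.inr h), rfl⟩, by simp⟩
  have hinterp {t : ℝ} (ht : t ∈ S) {y : ℝ}
      (h : ∃ e₁ ∈ (K t : Set Plane).extremePoints ℝ, ∃ e₂ ∈ (K t : Set Plane).extremePoints ℝ,
        ∃ w ∈ Set.Icc (0 : ℝ) 1, w = (x - e₂ 0) / (e₁ 0 - e₂ 0) ∧
          y = w * e₁ 1 + (1 - w) * e₂ 1) :
      ∃ w ∈ interpolants X P x, y = w.1 + w.2 * t := by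
    obtain ⟨e₁, he₁, e₂, he₂, w, hw, rfl, rfl⟩ := h
    obtain ⟨p₁, hp₁, h₁⟩ := hPmem ht he₁
    obtain ⟨p₂, hp₂, h₂⟩ := hPmem ht he₂
    refine ⟨_, ⟨e₁ 0, hXmem ht he₁, e₂ 0, hXmem ht he₂, p₁, hp₁, p₂, hp₂, hw, rfl⟩, ?_⟩
    rw [h₁, h₂]
    simp only [Prod.fst_add, Prod.snd_add, Prod.smul_fst, Prod.smul_snd, smul_eq_mul]
    ring
  have hTfin := finite_interpolants hXfin hPfin x
  have hup : ∀ t ∈ S, ∃ w ∈ interpolants X P x, upperFun (K t) x = w.1 + w.2 * t := fun t ht =>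
    hinterp ht (upperFun_eq_interpolation (shadow_of_mem_levelSet (hK t ht)) hx)
  have hlo : ∀ t ∈ S, ∃ w ∈ interpolants X P x, lowerFun (K t) x = w.1 + w.2 * t := fun t ht =>
    hinterp ht (lowerFun_eq_interpolation (shadow_of_mem_levelSet (hK t ht)) hx)
  choose! u hu hu' using hup
  choose! v hv hv' using hlo
  have hmaps : Set.MapsTo (fun t => (u t, v t)) S
      (interpolants X P x ×ˢ interpolants X P x) := fun t ht => ⟨hu t ht, hv t ht⟩
  obtain ⟨t, ht, t', ht', hne, heq⟩ := hS.exists_ne_map_eq_of_mapsTo hmaps (hTfin.prod hTfin)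
  obtain ⟨hut, hvt⟩ := Prod.ext_iff.1 heq
  simp only at hut hvt
  have hw {s : ℝ} (hs : s ∈ S) : upperFun (K s) x - lowerFun (K s) x = l + s := by
    rw [← hwidth s hs, ← ConvexBody.toReal_xrayY (shadow_of_mem_levelSet (hK s hs))
      (Set.Ioo_subset_Icc_self hx), ← ConvexBody.toReal_xrayY (shadow_of_mem_levelSet (hL s hs))
      (Set.Ioo_subset_Icc_self hx), hY hs x hx.1.ne' hx.2.ne]
  have w1 := hw ht
  have w2 := hw ht'
  rw [hu' t ht, hv' t ht] at w1
  rw [hu' t' ht', hv' t' ht', ← hut, ← hvt] at w2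
  have hslope : (u t).2 - (v t).2 = 1 := by
    have h1 : ((u t).2 - (v t).2 - 1) * (t - t') = 0 := by linarith
    rcases mul_eq_zero.1 h1 with h | h
    · linarith
    · exact absurd (sub_eq_zero.1 h) hne
  obtain ⟨-, h1, h2⟩ := interpolants_slope hP (hu t ht)
  obtain ⟨h3, -, -⟩ := interpolants_slope hP (hv t ht)
  have hu1 : (u t).2 = 1 := by linarith
  have := (K t).upperFun_mem (shadow_of_mem_levelSet (hK t ht)) (Set.Ioo_subset_Icc_self hx)
  rw [hu' t ht, h2 hu1, hu1, one_mul] at this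
  exact ⟨t, ht, this⟩

/-! ### Polygons with a moving vertex -/

theorem dist_vertical (x y y' : ℝ) : dist (!₂[x, y] : Plane) !₂[x, y'] = |y - y'| := by
  simp [EuclideanSpace.dist_eq, Real.dist_eq, Real.sqrt_sq_eq_abs]

theorem dist_horizontal (x x' y : ℝ) : dist (!₂[x, y] : Plane) !₂[x', y] = |x - x'| := by
  simp [EuclideanSpace.dist_eq, Real.dist_eq, Real.sqrt_sq_eq_abs]

/-- The convex hull of a non-empty finite set as a convex body. -/
def polygon (V : Set Plane) (hfin : V.Finite) (hne : V.Nonempty) : ConvexBody Plane where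
  carrier := convexHull ℝ V
  convex' := convex_convexHull ℝ V
  isCompact' := hfin.isCompact_convexHull ℝ
  nonempty' := hne.convexHull

theorem convex_box (a b c d : ℝ) : Convex ℝ (box a b c d) :=
  (convex_setOf_coord 0 (convex_Icc a b)).inter (convex_setOf_coord 1 (convex_Icc c d))

theorem mem_levelSet_of_touching {K : ConvexBody Plane} {a b c d : ℝ}
    (hsub : (K : Set Plane) ⊆ box a b c d) (ha : ∃ p ∈ K, p 0 = a) (hb : ∃ p ∈ K, p 0 = b)
    (hc : ∃ p ∈ K, p 1 = c) (hd : ∃ p ∈ K, p 1 = d) : K ∈ levelSet a b c d := by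
  have hconv (i : Fin 2) : (fun p : Plane => p i) '' (K : Set Plane) |>.OrdConnected :=
    (K.convex.isPreconnected.image _ (continuous_coord i).continuousOn).ordConnected
  change prodProj (K : Set Plane) = box a b c d
  ext p
  constructor
  · rintro ⟨⟨q, hq, hq0⟩, ⟨q', hq', hq1⟩⟩
    exact ⟨hq0 ▸ (hsub hq).1, hq1 ▸ (hsub hq').2⟩
  · rintro ⟨h0, h1⟩
    exact ⟨(hconv 0).out ha hb h0, (hconv 1).out hc hd h1⟩

/-- Adding to a polygon a vertex straight above it raises the upper end of the slice through that
vertex and keeps the lower end. -/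
theorem width_insert_vertex {M L : ConvexBody Plane} {V : Set Plane} {a b x t : ℝ}
    (hM : shadow M = Set.Icc a b) (hL : shadow L = Set.Icc a b) (hx : x ∈ Set.Icc a b)
    (hMV : (M : Set Plane) = convexHull ℝ V) (ht : 0 ≤ t)
    (hLV : (L : Set Plane) = convexHull ℝ (insert !₂[x, upperFun M x + t] V)) :
    upperFun L x - lowerFun L x = (upperFun M x - lowerFun M x) + t := by
  have hML : (M : Set Plane) ⊆ L := by
    rw [hMV, hLV]; exact convexHull_mono (Set.subset_insert _ _)
  have hpL : !₂[x, upperFun M x + t] ∈ L := by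
    rw [← SetLike.mem_coe, hLV]; exact subset_convexHull ℝ _ (Set.mem_insert _ _)
  have hle := ConvexBody.lowerFun_le_upperFun hM hx
  have hne : V.Nonempty := by
    rw [← convexHull_nonempty_iff (𝕜 := ℝ), ← hMV]; exact M.nonempty
  have hbound {y : ℝ} (hy : !₂[x, y] ∈ L) : lowerFun M x ≤ y ∧ y ≤ upperFun M x + t := by
    rw [← SetLike.mem_coe, hLV, convexHull_insert hne, mem_convexJoin] at hy
    obtain ⟨p, rfl, q, hq, r, s, hr, hs, hrs, hpq⟩ := hy
    rw [← hMV] at hq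
    rw [combo_eq] at hpq
    have e0 := congrArg (fun p : Plane => p 0) hpq
    have e1 := congrArg (fun p : Plane => p 1) hpq
    simp only [Matrix.cons_val_zero, Matrix.cons_val_one] at e0 e1
    obtain rfl : r = 1 - s := by linarith
    rcases hs.eq_or_lt with rfl | hs
    · constructor <;> linarith
    · have hq0 : q 0 = x := by
        have : s * (q 0 - x) = 0 := by linarith
        rcases mul_eq_zero.1 this with h | h <;> linarith
      obtain ⟨-, h1, h2⟩ := (ConvexBody.mem_iff hM).1 hq
      rw [hq0] at h1 h2
      constructor <;> nlinarith
  have h1 := (hbound (L.upperFun_mem hL hx)).2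
  have h2 := (hbound (L.lowerFun_mem hL hx)).1
  have h3 := ((ConvexBody.mem_mk_iff hL hx).1 hpL).2
  have h4 := ((ConvexBody.mem_mk_iff hL hx).1 (hML (M.lowerFun_mem hM hx))).1
  linarith

theorem dist_le_of_cthickening {K L : ConvexBody Plane} {r : ℝ} (hr : 0 ≤ r)
    (h1 : (L : Set Plane) ⊆ Metric.cthickening r K)
    (h2 : ∀ k ∈ K, ∃ p ∈ L, dist k p ≤ r) : dist L K ≤ r := by
  refine Metric.hausdorffDist_le_of_mem_dist hr (fun p hp => ?_) h2
  have hp' := h1 hp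
  rw [K.isCompact.cthickening_eq_biUnion_closedBall hr] at hp'
  simpa using hp'

/-- Near every inscribed body there are polygons inscribed in the same box with one vertex free to
move along a given vertical, which lies above a given level below the upper boundary. -/
theorem exists_moving_polygons {K : ConvexBody Plane} {a b c d x y₁ ε : ℝ}
    (hK : K ∈ levelSet a b c d) (hcd : c < d) (hx : x ∈ Set.Ioo a b) (hy₁ : y₁ < upperFun K x)
    (hε : 0 < ε) :
    ∃ (V : Set Plane) (y₀ l : ℝ) (S : Set ℝ) (L : ℝ → ConvexBody Plane), V.Finite ∧ y₁ < y₀ ∧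
      S.Infinite ∧ ∀ t ∈ S, 0 < t ∧ L t ∈ levelSet a b c d ∧
        (L t : Set Plane) = convexHull ℝ (insert !₂[x, y₀ + t] V) ∧
        upperFun (L t) x - lowerFun (L t) x = l + t ∧ dist (L t) K ≤ 2 * ε := by
  have hsh := shadow_of_mem_levelSet hK
  have hsh' := shadow_swapBody_of_mem_levelSet hK
  rw [shadow_swapBody] at hsh'
  have hxm := Set.Ioo_subset_Icc_self hx
  have hab : a < b := hx.1.trans hx.2
  have hKbox := subset_box_of_mem_levelSet hK
  have htopK := K.upperFun_mem hsh hxm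
  obtain ⟨zL, hzL, hzL0⟩ : a ∈ shadow (K : Set Plane) := by
    rw [hsh]; exact Set.left_mem_Icc.2 hab.le
  obtain ⟨zR, hzR, hzR0⟩ : b ∈ shadow (K : Set Plane) := by
    rw [hsh]; exact Set.right_mem_Icc.2 hab.le
  obtain ⟨zB, hzB, hzB1⟩ : c ∈ (fun q : Plane => q 1) '' (K : Set Plane) := by
    rw [hsh']; exact Set.left_mem_Icc.2 hcd.le
  obtain ⟨zT, hzT, hzT1⟩ : d ∈ (fun q : Plane => q 1) '' (K : Set Plane) := by
    rw [hsh']; exact Set.right_mem_Icc.2 hcd.le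
  simp only at hzL0 hzR0 hzB1 hzT1
  have hupd : upperFun K x ≤ d := by simpa using (hKbox htopK).2.2
  -- the body is cut off at height `d - δ`, so that only one vertex touches the upper side
  obtain ⟨δ, hδ0, hδε, hδc, hδy⟩ : ∃ δ > 0, δ ≤ ε ∧ δ ≤ d - c ∧ δ < d - y₁ := by
    refine ⟨min ε (min (d - c) ((d - y₁) / 2)), lt_min hε (lt_min (by linarith) (by linarith)),
      min_le_left _ _, (min_le_right _ _).trans (min_le_left _ _), ?_⟩
    have : min ε (min (d - c) ((d - y₁) / 2)) ≤ (d - y₁) / 2 :=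
      (min_le_right _ _).trans (min_le_right _ _)
    linarith
  let cap : Plane → Plane := fun z => !₂[z 0, min (z 1) (d - δ)]
  have hcap0 (z : Plane) : cap z 0 = z 0 := rfl
  have hcap1 (z : Plane) : cap z 1 = min (z 1) (d - δ) := rfl
  have hcapd {z : Plane} (hz : z ∈ K) : dist z (cap z) ≤ δ := by
    have := dist_vertical (z 0) (z 1) (min (z 1) (d - δ))
    rw [plane_eta] at this
    rw [show dist z (cap z) = _ from this, abs_of_nonneg (by linarith [min_le_left (z 1) (d - δ)])]
    rcases min_cases (z 1) (d - δ) with h | h <;> linarith [(hKbox hz).2.2]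
  obtain ⟨N₀, hN₀K, hN₀fin, hN₀⟩ := K.isCompact.finite_cover_balls hε
  set N : Set Plane := insert zL (insert zR (insert zB (insert !₂[x, upperFun K x] N₀))) with hN
  have hNfin : N.Finite := (((hN₀fin.insert _).insert _).insert _).insert _
  have hNK : N ⊆ K := by
    rintro z (rfl | rfl | rfl | rfl | hz)
    exacts [hzL, hzR, hzB, htopK, hN₀K hz]
  -- a touching point of the upper side close to one of `K` but off the vertical through `x`
  obtain ⟨s, hsx, hsab, hsT⟩ : ∃ s, s ≠ x ∧ s ∈ Set.Icc a b ∧ |s - zT 0| ≤ ε := by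
    by_cases h : zT 0 = x
    · refine ⟨max a (x - ε), ?_, ⟨le_max_left _ _, max_le hab.le (by linarith [hx.2])⟩, ?_⟩
      · exact (max_lt hx.1 (by linarith)).ne
      · rw [h, abs_le]
        exact ⟨by linarith [le_max_right a (x - ε)],
          by linarith [max_lt hx.1 (show x - ε < x by linarith)]⟩
    · exact ⟨zT 0, h, (hKbox hzT).1, by simpa using hε.le⟩
  set W : Set Plane := cap '' N with hW
  set V : Set Plane := insert !₂[s, d] W with hV
  have hWne : W.Nonempty := ⟨_, zL, Set.mem_insert _ _, rfl⟩
  have hVfin : V.Finite := (hNfin.image _).insert _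
  have hWbox : W ⊆ box a b c d := by
    rintro _ ⟨z, hz, rfl⟩
    have hzb := hKbox (hNK hz)
    exact ⟨hzb.1, le_min hzb.2.1 (by linarith), (min_le_left _ _).trans hzb.2.2⟩
  have hVbox : V ⊆ box a b c d := by
    rintro _ (rfl | hz)
    · exact ⟨hsab, ⟨hcd.le, le_rfl⟩⟩
    · exact hWbox hz
  have hVK : V ⊆ Metric.cthickening ε (K : Set Plane) := by
    rintro _ (rfl | ⟨z, hz, rfl⟩)
    · refine Metric.mem_cthickening_of_dist_le _ zT _ _ hzT ?_
      have := dist_horizontal s (zT 0) (zT 1)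
      rw [plane_eta, hzT1] at this
      rw [this]; exact hsT
    · refine Metric.mem_cthickening_of_dist_le _ z _ _ (hNK hz) ?_
      rw [dist_comm]; exact (hcapd (hNK hz)).trans hδε
  -- every body inscribed in the box and containing the vertices lies in the level set
  have hlevel {L : ConvexBody Plane} (hVL : V ⊆ L) (hLb : (L : Set Plane) ⊆ box a b c d) :
      L ∈ levelSet a b c d := by
    have hcapL {z : Plane} (hz : z ∈ N) : cap z ∈ L := hVL (Or.inr ⟨z, hz, rfl⟩)
    refine mem_levelSet_of_touching hLb ⟨_, hcapL (Or.inl rfl), hzL0⟩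
      ⟨_, hcapL (Or.inr (Or.inl rfl)), hzR0⟩ ⟨_, hcapL (Or.inr (Or.inr (Or.inl rfl))), ?_⟩
      ⟨_, hVL (Or.inl rfl), rfl⟩
    rw [hcap1, hzB1]; exact min_eq_left (by linarith)
  set M := polygon V hVfin (Set.insert_nonempty _ _) with hMdef
  have hMV : (M : Set Plane) = convexHull ℝ V := rfl
  have hMlev : M ∈ levelSet a b c d := hlevel (subset_convexHull ℝ V)
    (convexHull_min hVbox (convex_box a b c d))
  have hMsh := shadow_of_mem_levelSet hMlev
  set y₀ := upperFun M x with hy₀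
  have hy₀M : !₂[x, y₀] ∈ M := M.upperFun_mem hMsh hxm
  have hy₀y₁ : y₁ < y₀ := by
    have h1 : !₂[x, min (upperFun K x) (d - δ)] ∈ M :=
      subset_convexHull ℝ V (Or.inr ⟨!₂[x, upperFun K x],
        Or.inr (Or.inr (Or.inr (Or.inl rfl))), rfl⟩)
    exact (lt_min hy₁ (by linarith)).trans_le ((ConvexBody.mem_mk_iff hMsh hxm).1 h1).2
  have hy₀d : y₀ < d := by
    have hWd : convexHull ℝ W ⊆ {p : Plane | p 1 ≤ d - δ} := by
      refine convexHull_min ?_ (convex_setOf_coord 1 (convex_Iic (d - δ)))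
      rintro _ ⟨z, -, rfl⟩
      exact min_le_right (z 1) (d - δ)
    have h1 := hy₀M
    rw [← SetLike.mem_coe, hMV, hV, convexHull_insert hWne, mem_convexJoin] at h1
    obtain ⟨p, rfl, q, hq, r, u, hr, hu, hru, hpq⟩ := h1
    have hq1 : q 1 ≤ d - δ := hWd hq
    rw [combo_eq] at hpq
    have e0 := congrArg (fun p : Plane => p 0) hpq
    have e1 := congrArg (fun p : Plane => p 1) hpq
    simp only [Matrix.cons_val_zero, Matrix.cons_val_one] at e0 e1
    obtain rfl : r = 1 - u := by linarith
    rcases hu.eq_or_lt with rfl | hu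
    · exact absurd (by linarith) hsx
    · nlinarith
  let L : ℝ → ConvexBody Plane := fun t =>
    polygon (insert !₂[x, y₀ + t] V) (hVfin.insert _) (Set.insert_nonempty _ _)
  refine ⟨V, y₀, upperFun M x - lowerFun M x, Set.Ioo 0 (min ε (d - y₀)), L, hVfin, hy₀y₁,
    Set.Ioo_infinite (lt_min hε (by linarith)), fun t ht => ?_⟩
  have htε : t ≤ ε := ht.2.le.trans (min_le_left _ _)
  have htd : t ≤ d - y₀ := ht.2.le.trans (min_le_right _ _)
  have hLV : (L t : Set Plane) = convexHull ℝ (insert !₂[x, y₀ + t] V) := rfl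
  have hy₀c : c ≤ y₀ := by simpa using (subset_box_of_mem_levelSet hMlev hy₀M).2.1
  have hVL : V ⊆ L t := (Set.subset_insert _ _).trans (subset_convexHull ℝ _)
  have hLlev : L t ∈ levelSet a b c d := by
    refine hlevel hVL (convexHull_min (Set.insert_subset ?_ hVbox) (convex_box a b c d))
    refine ⟨hxm, ?_, ?_⟩
    · change c ≤ y₀ + t
      linarith [ht.1]
    · change y₀ + t ≤ d
      linarith
  refine ⟨ht.1, hLlev, hLV, ?_, ?_⟩
  · exact width_insert_vertex hMsh (shadow_of_mem_levelSet hLlev) hxm hMV ht.1.le hLV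
  · refine dist_le_of_cthickening (by linarith) ?_ fun k hk => ?_
    · rw [hLV]
      refine convexHull_min (Set.insert_subset ?_ ?_) (K.convex.cthickening _)
      · have h1 : !₂[x, y₀] ∈ Metric.cthickening ε (K : Set Plane) :=
          convexHull_min hVK (K.convex.cthickening _) hy₀M
        have h2 : !₂[x, y₀ + t] ∈ Metric.cthickening ε (Metric.cthickening ε (K : Set Plane)) := by
          refine Metric.mem_cthickening_of_dist_le _ _ _ _ h1 ?_
          rw [dist_vertical, add_sub_cancel_left, abs_of_pos ht.1]; exact htε
        rw [two_mul]
        exact Metric.cthickening_cthickening_subset hε.le hε.le _ h2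
      · exact hVK.trans (Metric.cthickening_mono (by linarith) _)
    · obtain ⟨z, hz, hkz⟩ := Set.mem_iUnion₂.1 (hN₀ hk)
      have hzN : z ∈ N := Or.inr (Or.inr (Or.inr (Or.inr hz)))
      refine ⟨cap z, hVL (Or.inr ⟨z, hzN, rfl⟩), ?_⟩
      calc dist k (cap z) ≤ dist k z + dist z (cap z) := dist_triangle _ _ _
        _ ≤ ε + δ := add_le_add (Metric.mem_ball.1 hkz).le (hcapd (hNK hzN))
        _ ≤ 2 * ε := by linarith

/-- If `Φ K = Φ K'` and `K` rises above `K'` somewhere, the inverse of `Φ` is not lower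
semi-continuous at this value: polygons near `K` with a moving vertex off `K'` exclude bodies near
`K'` with the same value. -/
theorem not_inverseLowerSemicontinuousAt {W : Type*} [TopologicalSpace W] {a b c d x : ℝ}
    {Φ : levelSet a b c d → W} (hΦ : Continuous Φ)
    (hsep : ∀ L L', Φ L = Φ L' → conicMap a b c d L = conicMap a b c d L')
    {K K' : levelSet a b c d} (hKK' : Φ K = Φ K') (hcd : c < d) (hx : x ∈ Set.Ioo a b)
    (hlt : upperFun K'.1 x < upperFun K.1 x) : ¬ InverseLowerSemicontinuousAt Φ K := by
  intro hlsc
  rw [InverseLowerSemicontinuousAt, lowerHemicontinuousAt_iff] at hlsc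
  obtain ⟨y₁, hy₁, hy₁'⟩ := exists_between hlt
  -- a neighbourhood of `K'` whose members avoid the vertical ray above `(x, y₁)`
  have hclosed : IsClosed {p : Plane | p 0 = x ∧ y₁ ≤ p 1} :=
    (isClosed_eq (continuous_coord 0) continuous_const).inter
      (isClosed_le continuous_const (continuous_coord 1))
  have hdisj : Disjoint (K'.1 : Set Plane) {p : Plane | p 0 = x ∧ y₁ ≤ p 1} := by
    rw [Set.disjoint_left]
    rintro p hp ⟨hp0, hp1⟩
    have := ((ConvexBody.mem_iff (shadow_of_mem_levelSet K'.2)).1 hp).2.2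
    rw [hp0] at this
    linarith
  obtain ⟨δ, hδ, hthick⟩ := hdisj.exists_thickenings K'.1.isCompact hclosed
  have havoid {L : levelSet a b c d} (hL : L ∈ Metric.ball K' δ) {y : ℝ} (hy : y₁ ≤ y) :
      !₂[x, y] ∉ L.1 := by
    intro hmem
    obtain ⟨k, hk, hdk⟩ := Metric.exists_dist_lt_of_hausdorffDist_lt hmem
      (show Metric.hausdorffDist (L.1 : Set Plane) K'.1 < δ from hL) ConvexBody.hausdorffEDist_ne_top
    refine Set.disjoint_left.1 hthick (Metric.mem_thickening_iff.2 ⟨k, hk, hdk⟩)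
      (Metric.self_subset_thickening hδ _ ⟨rfl, hy⟩)
  have hev := hlsc (Metric.ball K' δ) Metric.isOpen_ball ⟨K', hKK'.symm, Metric.mem_ball_self hδ⟩
  have hcont : Continuous (Set.rangeFactorization Φ) := hΦ.subtype_mk _
  obtain ⟨ε, hε, hball⟩ := Metric.eventually_nhds_iff.1 (hcont.continuousAt.eventually hev)
  obtain ⟨V, y₀, l, S, L, hVfin, hy₀, hS, hL⟩ :=
    exists_moving_polygons K.2 hcd hx hy₁' (show 0 < ε / 4 by linarith)
  have hcompanion : ∀ t ∈ S, ∃ M : ConvexBody Plane, M ∈ levelSet a b c d ∧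
      (∀ p, p 0 ∈ Set.Ioo a b → p 1 ∈ Set.Ioo c d → conicFun M p = conicFun (L t) p) ∧
      ∀ y, y₁ ≤ y → !₂[x, y] ∉ M := by
    intro t ht
    obtain ⟨ht0, hlev, -, -, hdist⟩ := hL t ht
    obtain ⟨M, hM, hMball⟩ := hball (y := ⟨L t, hlev⟩)
      (show dist (L t) K.1 < ε by linarith)
    refine ⟨M.1, M.2, fun p hp0 hp1 => ?_, fun y hy => havoid hMball hy⟩
    have h1 : conicMap a b c d M = conicMap a b c d ⟨L t, hlev⟩ := hsep _ _ hM
    exact DFunLike.congr_fun h1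
      ⟨p, Set.Ioo_subset_Icc_self hp0, Set.Ioo_subset_Icc_self hp1⟩
  choose! M hMlev hMconic hMavoid using hcompanion
  obtain ⟨t, ht, hmem⟩ := exists_moving_vertex_mem hx hcd hVfin hS hMlev
    (fun t ht => (hL t ht).2.1) (fun t ht => (hL t ht).2.2.1) (fun t ht => (hL t ht).2.2.2.1)
    hMconic
  exact hMavoid t ht _ (by linarith [(hL t ht).1]) hmem

/-! ### Determination by X-rays and lower semi-continuity -/

theorem shadow_subset_of_ae_xrayY_eq {K L : ConvexBody Plane} {a b a' b' : ℝ}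
    (hK : shadow K = Set.Icc a b) (hL : shadow L = Set.Icc a' b')
    (hi : (interior (K : Set Plane)).Nonempty) (h : ∀ᵐ x : ℝ, xrayY K x = xrayY L x) :
    Set.Icc a b ⊆ Set.Icc a' b' := by
  have hab := shadow_lt_of_interior hK hi
  rw [← closure_Ioo hab.ne]
  refine closure_minimal (fun x hx => ?_) isClosed_Icc
  by_contra hx'
  have hopen : IsOpen (Set.Ioo a b ∩ (Set.Icc a' b')ᶜ) :=
    isOpen_Ioo.inter isClosed_Icc.isOpen_compl
  refine (hopen.measure_pos volume ⟨x, hx, hx'⟩).ne' (measure_mono_null ?_ h)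
  rintro z ⟨hz, hz'⟩ hz_eq
  replace hz_eq : xrayY K z = xrayY L z := hz_eq
  rw [ConvexBody.xrayY_eq_zero hL hz', ConvexBody.xrayY_eq hK (Set.Ioo_subset_Icc_self hz),
    ENNReal.ofReal_eq_zero] at hz_eq
  linarith [lowerFun_lt_upperFun hK hi hz]

theorem shadow_eq_of_ae_xrayY_eq {K L : ConvexBody Plane}
    (hK : (interior (K : Set Plane)).Nonempty) (hL : (interior (L : Set Plane)).Nonempty)
    (h : ∀ᵐ x : ℝ, xrayY K x = xrayY L x) : shadow K = shadow L := by
  obtain ⟨a, b, -, h1⟩ := K.exists_shadow_eq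
  obtain ⟨a', b', -, h2⟩ := L.exists_shadow_eq
  rw [h1, h2]
  exact (shadow_subset_of_ae_xrayY_eq h1 h2 hK h).antisymm
    (shadow_subset_of_ae_xrayY_eq h2 h1 hL (h.mono fun _ hx => hx.symm))

/-- The X-rays of a body with interior points determine its bounding box. -/
theorem mem_levelSet_of_sameXrays {K L : ConvexBody Plane} {a b c d : ℝ}
    (hKB : K ∈ levelSet a b c d) (hK : (interior (K : Set Plane)).Nonempty)
    (hL : (interior (L : Set Plane)).Nonempty) (h : SameXrays K L) : L ∈ levelSet a b c d := by
  obtain ⟨hab, hcd⟩ := le_of_mem_levelSet hKB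
  rw [mem_levelSet_iff hab hcd] at hKB ⊢
  refine ⟨?_, ?_⟩
  · rw [← hKB.1, shadow_eq_of_ae_xrayY_eq hK hL h.1]
  · rw [← hKB.2]
    refine (shadow_eq_of_ae_xrayY_eq (interior_swapBody_nonempty hK)
      (interior_swapBody_nonempty hL) ?_).symm
    rw [xrayY_swapBody, xrayY_swapBody]
    exact h.2

theorem subset_of_boundary_eq {K L : ConvexBody Plane} {a b : ℝ} (hab : a < b)
    (hK : shadow K = Set.Icc a b) (hL : shadow L = Set.Icc a b)
    (hu : ∀ x ∈ Set.Ioo a b, upperFun K x = upperFun L x)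
    (hl : ∀ x ∈ Set.Ioo a b, lowerFun K x = lowerFun L x) : (K : Set Plane) ⊆ L := by
  intro k hk
  have hm : (a + b) / 2 ∈ Set.Ioo a b := ⟨by linarith, by linarith⟩
  have hmK := K.upperFun_mem hK (Set.Ioo_subset_Icc_self hm)
  -- `k` is a limit of points of `K` over the open interval
  have hsub : openSegment ℝ k !₂[(a + b) / 2, upperFun K ((a + b) / 2)] ⊆ L := by
    rintro p ⟨r, s, hr, hs, hrs, rfl⟩
    have hp := K.convex hk hmK hr.le hs.le hrs
    have hk0 := ConvexBody.mem_shadow hK hk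
    rw [combo_eq] at hp ⊢
    simp only [Matrix.cons_val_zero, Matrix.cons_val_one] at hp ⊢
    obtain rfl : r = 1 - s := by linarith
    have hx : (1 - s) * k 0 + s * ((a + b) / 2) ∈ Set.Ioo a b := by
      constructor <;> nlinarith [hk0.1, hk0.2, mul_pos hs (sub_pos.2 hab)]
    have hxm := Set.Ioo_subset_Icc_self hx
    rw [SetLike.mem_coe, ConvexBody.mem_mk_iff hK hxm, hu _ hx, hl _ hx] at hp
    exact (ConvexBody.mem_mk_iff hL hxm).2 hp
  have := closure_minimal hsub L.isClosed
  rw [closure_openSegment] at this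
  exact this (left_mem_segment ℝ _ _)

/-- Two different bodies in the same box with the same X-rays have different upper boundaries. -/
theorem exists_upperFun_ne {K L : ConvexBody Plane} {a b c d : ℝ} (hab : a < b) (hcd : c < d)
    (hK : K ∈ levelSet a b c d) (hL : L ∈ levelSet a b c d) (hne : K ≠ L)
    (h : conicFun K = conicFun L) : ∃ x ∈ Set.Ioo a b, upperFun K x ≠ upperFun L x := by
  by_contra! hu
  have hK' := shadow_of_mem_levelSet hK
  have hL' := shadow_of_mem_levelSet hL
  have hl : ∀ x ∈ Set.Ioo a b, lowerFun K x = lowerFun L x := fun x hx => by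
    have hw := xrayY_eq_of_eqOn_box hK' hL' hcd (fun p _ _ => by rw [h]) hx.1.ne' hx.2.ne
    have h1 := ConvexBody.toReal_xrayY hK' (Set.Ioo_subset_Icc_self hx)
    have h2 := ConvexBody.toReal_xrayY hL' (Set.Ioo_subset_Icc_self hx)
    rw [hw, h2, hu x hx] at h1
    linarith
  exact hne (ConvexBody.ext ((subset_of_boundary_eq hab hK' hL' hu hl).antisymm
    (subset_of_boundary_eq hab hL' hK' (fun x hx => (hu x hx).symm) fun x hx => (hl x hx).symm)))

/-- The equivalence for any continuous map that is injective on the values of the conic function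
restricted to the box. -/
theorem determinedByXrays_iff_inverseLowerSemicontinuousAt {W : Type*} [TopologicalSpace W]
    [T2Space W] {a b c d : ℝ} {Φ : levelSet a b c d → W} (hΦ : Continuous Φ)
    (hsep : ∀ L L', Φ L = Φ L' ↔ conicMap a b c d L = conicMap a b c d L')
    {K : ConvexBody Plane} (hK : (interior (K : Set Plane)).Nonempty)
    (hB : K ∈ levelSet a b c d) :
    DeterminedByXrays K ↔ InverseLowerSemicontinuousAt Φ ⟨K, hB⟩ := by
  have hab := shadow_lt_of_interior (shadow_of_mem_levelSet hB) hK
  have hcd := shadow_lt_of_interior (shadow_swapBody_of_mem_levelSet hB)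
    (interior_swapBody_nonempty hK)
  constructor
  · intro hdet
    have := compactSpace_levelSet a b c d
    refine inverseLowerSemicontinuousAt_of_fiber_eq hΦ fun L hL => ?_
    have hX : SameXrays K L.1 := sameXrays_of_eqOn_box hab hcd hB L.2 fun p hp0 hp1 =>
      (DFunLike.congr_fun ((hsep _ _).1 hL)
        ⟨p, Set.Ioo_subset_Icc_self hp0, Set.Ioo_subset_Icc_self hp1⟩).symm
    exact Subtype.ext (hdet L.1 (interior_nonempty_of_sameXrays hK hX) hX).symm
  · intro hlsc K' hK' hX
    by_contra hne
    have hB' := mem_levelSet_of_sameXrays hB hK hK' hX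
    have hconic := conicFun_eq_of_sameXrays hX
    have hΦeq : Φ ⟨K, hB⟩ = Φ ⟨K', hB'⟩ := by
      refine (hsep _ _).2 (ContinuousMap.ext fun p => ?_)
      exact congrFun hconic p.1
    obtain ⟨x, hx, hxne⟩ := exists_upperFun_ne hab hcd hB hB' hne hconic
    rcases lt_or_gt_of_ne hxne with h | h
    · refine not_inverseLowerSemicontinuousAt hΦ (fun L L' => (hsep L L').1) hΦeq.symm hcd hx h ?_
      -- lower semi-continuity only depends on the common value of `Φ`
      have hval : Set.rangeFactorization Φ ⟨K, hB⟩ = Set.rangeFactorization Φ ⟨K', hB'⟩ :=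
        Subtype.ext hΦeq
      rw [InverseLowerSemicontinuousAt, hval] at hlsc
      exact hlsc
    · exact not_inverseLowerSemicontinuousAt hΦ (fun L L' => (hsep L L').1) hΦeq hcd hx h hlsc

theorem theorem5 (K : ConvexBody Plane) (hK : (interior (K : Set Plane)).Nonempty)
    (a b c d : ℝ) (hB : K ∈ levelSet a b c d) :
    (DeterminedByXrays K ↔ DeterminedByConicFun K) ∧
    (DeterminedByXrays K ↔ InverseLowerSemicontinuousAt (conicMap a b c d) ⟨K, hB⟩) ∧
    (DeterminedByXrays K ↔ InverseLowerSemicontinuousAt (conicMapL1 a b c d) ⟨K, hB⟩) := by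
  have hab := shadow_lt_of_interior (shadow_of_mem_levelSet hB) hK
  have hcd := shadow_lt_of_interior (shadow_swapBody_of_mem_levelSet hB)
    (interior_swapBody_nonempty hK)
  have := t2Space_continuousL1 hab hcd
  exact ⟨determinedByXrays_iff_determinedByConicFun K,
    determinedByXrays_iff_inverseLowerSemicontinuousAt (continuous_conicMap a b c d)
      (fun _ _ => Iff.rfl) hK hB,
    determinedByXrays_iff_inverseLowerSemicontinuousAt (continuous_conicMapL1 a b c d)
      (fun _ _ => Iff.rfl) hK hB⟩
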